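/- **Theorem 1.2.** By a square we mean the boundary of a non-degenerate axis-parallel square in the Euclidean plane $\mathbb{R}^2$, that is, a set $\{(x,y) : \max(|x-a|,|y-b|)=r\}$ with $r>0$; the point $(a,b)$ is its centre. For $A\subset\mathbb{R}^2$ and $\delta>0$ let $N_\delta(A)\in\{0,1,2,\dots\}\cup\{\infty\}$ be the least number of closed balls of radius $\delta$ that cover $A$. The lower and upper box dimensions of $A$ are $$\underline{\dim}_B A=\liminf_{\delta\to0^+}\frac{\log N_\delta(A)}{-\log\delta},\qquad \overline{\dim}_B A=\limsup_{\delta\to0^+}\frac{\log N_\delta(A)}{-\log\delta}$$ (both are $+\infty$ if $A$ is unbounded). For $s\ge0$ put $$\mathcal{P}^s_0(A)=\lim_{\delta\to0^+}\sup\Big\{\sum_i(2r_i)^s\Big\},$$ where the supremum is over all families of pairwise disjoint closed balls with centres in $A$ and radii $r_i\in(0,\delta]$, and let $$\mathcal{P}^s(A)=\inf\Big\{\sum_{i=1}^\infty\mathcal{P}^s_0(A_i) : A\subset\bigcup_{i=1}^\infty A_i\Big\}$$ be the $s$-dimensional packing measure. The packing dimension of $A$ is $\dim_P A=\sup\{s\ge0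 : \mathcal{P}^s(A)=\infty\}$, with $\sup\emptyset=0$. 1. If $B\subset\mathbb{R}^2$ is any set that contains a square centred at every point of $[0,1]^2$, then $$\dim_P B\ge\tfrac74,\qquad \underline{\dim}_B B\ge\tfrac74,\qquad \overline{\dim}_B B\ge\tfrac74.$$ 2. There is a compact set $B\subset\mathbb{R}^2$ that contains a square centred at every point of $[0,1]^2$ and satisfies $$\dim_P B=\underline{\dim}_B B=\overline{\dim}_B B=\tfrac74.$$ -/

import Mathlib

open Set Filter Topology
open scoped NNReal ENNReal

/-- The Euclidean plane. -/
abbrev Plane : Type := EuclideanSpace ℝ (Fin 2)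

/-- The boundary of the axis-parallel square with centre `c` and side length `2 * r`. -/
def squareBoundary (c : Plane) (r : ℝ) : Set Plane :=
  {p | max |p 0 - c 0| |p 1 - c 1| = r}

/-- `B` contains the boundary of a non-degenerate axis-parallel square centred at every point
of `[0,1]²`. -/
def ContainsAllSquares (B : Set Plane) : Prop :=
  ∀ c : Plane, c 0 ∈ Icc (0 : ℝ) 1 → c 1 ∈ Icc (0 : ℝ) 1 →
    ∃ r : ℝ, 0 < r ∧ squareBoundary c r ⊆ B

section BoxDimension

variable {X : Type*} [PseudoEMetricSpace X]

/-- The quotient `log N_δ(A) / (-log δ)`, where `N_δ(A)` is the least number of closed balls of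
radius `δ` that cover `A` (it is `⊤` if no finite number suffices). -/
noncomputable def boxQuotient (A : Set X) (δ : ℝ≥0) : EReal :=
  ENNReal.log (Metric.externalCoveringNumber δ A : ℝ≥0∞) / ((-Real.log (δ : ℝ) : ℝ) : EReal)

/-- The lower box counting dimension. -/
noncomputable def lowerBoxDim (A : Set X) : EReal :=
  liminf (boxQuotient A) (𝓝[>] (0 : ℝ≥0))

/-- The upper box counting dimension. -/
noncomputable def upperBoxDim (A : Set X) : EReal :=
  limsup (boxQuotient A) (𝓝[>] (0 : ℝ≥0))

end BoxDimension

section PackingDimension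

variable {X : Type*} [PseudoMetricSpace X]

/-- A `δ`-packing of `A`: a family of pairwise disjoint closed balls with centres in `A` and radii
in `(0, δ]`, given by the set of its pairs (centre, radius). -/
def IsBallPacking (A : Set X) (δ : ℝ) (P : Set (X × ℝ)) : Prop :=
  (∀ b ∈ P, b.1 ∈ A ∧ 0 < b.2 ∧ b.2 ≤ δ) ∧
    P.PairwiseDisjoint fun b => Metric.closedBall b.1 b.2

/-- `𝒫ˢ_δ(A)`: the supremum of `∑ (2 rᵢ)ˢ` over the `δ`-packings of `A` by balls of
radii `rᵢ`. -/
noncomputable def packingPreContent (s : ℝ≥0) (δ : ℝ) (A : Set X) : ℝ≥0∞ :=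
  ⨆ (P : Set (X × ℝ)) (_ : IsBallPacking A δ P), ∑' b : P, ENNReal.ofReal (2 * b.1.2) ^ (s : ℝ)

/-- `𝒫ˢ₀(A)`, the limit of `𝒫ˢ_δ(A)` as `δ` decreases to `0`. Since `𝒫ˢ_δ(A)` is monotone in `δ`
the limit is the infimum. -/
noncomputable def packingPreMeasure (s : ℝ≥0) (A : Set X) : ℝ≥0∞ :=
  ⨅ (δ : ℝ) (_ : 0 < δ), packingPreContent s δ A

/-- The `s`-dimensional packing measure
`𝒫ˢ(A) = inf {∑ᵢ 𝒫ˢ₀(Aᵢ) : A ⊆ ⋃ᵢ Aᵢ}`, over countable covers. -/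
noncomputable def packingMeasure (s : ℝ≥0) (A : Set X) : ℝ≥0∞ :=
  ⨅ (F : ℕ → Set X) (_ : A ⊆ ⋃ i, F i), ∑' i, packingPreMeasure s (F i)

/-- The packing dimension `sup {s ≥ 0 : 𝒫ˢ(A) = ∞}`. -/
noncomputable def packingDim (A : Set X) : ℝ≥0∞ :=
  ⨆ (s : ℝ≥0) (_ : packingMeasure s A = ∞), (s : ℝ≥0∞)

end PackingDimension

/-!
The lower bounds rest on a count for the vertices of squares. If `G` is a finite set of `N` points,
then the squares with all four vertices in `G` have `O(N ^ (4/3))` centres: call a diagonal line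
(of slope `1` or `-1`) rich if it contains more than `T = N ^ (1/3)` points of `G`. A centre of a
square one of whose vertices is on a poor diagonal is the midpoint of this vertex and the opposite
one, which leaves `O(N T)` possibilities; every other centre is the intersection of two rich
diagonals, and there are at most `N / T` of them for each slope. This is `card_centers_le`, for
squares up to an error of one unit.

Let `F` contain on each of the four side lines of the squares with centres in `S` a segment of a
fixed length. The lines in question meet the `δ`-grid in `M` columns and `M` rows, and covering the
segments by balls of radius `δ` takes at least of the order of `M / δ` balls. The count, applied
to the product of these sets of rows and columns, gives `|S| ≲ (M ^ 2) ^ (4/3) δ ^ 2`. Hence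
`N_δ(F) ≳ δ ^ (-7/4)` as soon as `S` has positive outer measure
(`exists_le_externalCoveringNumber`). By the Baire category theorem, whenever `B` is covered by
countably many closed sets, a finite union of these is such an `F`
(`exists_volume_lineSquareCenters_ne_zero`). For the box dimensions the closed sets are all equal to
`closure B`; for the packing dimension they are the closures of the pieces in the definition of the
packing measure, for which finite packing premeasure bounds the covering numbers.

For the example, let `W j` (`digitCantor j`, `j < 4`) be the set of numbers such that in each
hexadecimal digit after the point the bit of weight `2 ^ j` is zero. At the scale `16 ^ (-L)` it
takes `8 ^ L` cells per unit length. For all `a, b` there is `r` with `a + r ∈ W 0`, `a - r ∈ W 1`,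
`b + r ∈ W 2` and `b - r ∈ W 3`: when `a` and `b` are multiples of `16 ^ (-L)`, the bits of `r` are
found one by one, starting with the lowest, since each of them has to control only one of the four
numbers; the general case follows by compactness. So the points of a large square one of whose
coordinates is in some `W j` form a compact set which contains the required squares and is covered
by `O(8 ^ L * 16 ^ L) = O((16 ^ L) ^ (7/4))` cells of side `16 ^ (-L)`.
-/

/-! ### Centres of squares with vertices in a finite grid -/

/-- Say that a point of `G` is poor if its fibre under `φ` has at most `T` elements. There are at
most `3 T |G|` pairs of points of `G` whose `φ`-values differ by at most one and of which the
first is poor. -/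
theorem card_pairs_poor_le {α : Type*} [DecidableEq α] (G : Finset α) (φ : α → ℤ) (T : ℝ)
    (hT : 0 ≤ T) :
    ((((G ×ˢ G).filter fun z => ((G.filter fun p => φ p = φ z.1).card : ℝ) ≤ T ∧
      |φ z.2 - φ z.1| ≤ 1).card : ℕ) : ℝ) ≤ 3 * T * G.card := by
  classical
  set S := (G ×ˢ G).filter fun z => ((G.filter fun p => φ p = φ z.1).card : ℝ) ≤ T ∧
      |φ z.2 - φ z.1| ≤ 1 with hS
  have hfib : S.card = ∑ q ∈ G, (S.filter fun z => z.2 = q).card :=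
    Finset.card_eq_sum_card_fiberwise (fun z hz => by
      simp only [hS, Finset.coe_filter, Finset.mem_product, Set.mem_ofPred_eq] at hz
      exact hz.1.2)
  have hq : ∀ q ∈ G, (((S.filter fun z => z.2 = q).card : ℕ) : ℝ) ≤ 3 * T := by
    intro q _
    have hε : ∀ ε : ℤ, (((S.filter fun z => z.2 = q ∧ φ z.1 = φ q + ε).card : ℕ) : ℝ) ≤ T := by
      intro ε
      rcases (S.filter fun z => z.2 = q ∧ φ z.1 = φ q + ε).eq_empty_or_nonempty with h | ⟨z, hz⟩
      · simpa [h] using hT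
      · simp only [hS, Finset.mem_filter, Finset.mem_product] at hz
        refine le_trans ?_ hz.1.2.1
        norm_cast
        refine Finset.card_le_card_of_injOn Prod.fst ?_ ?_
        · intro w hw
          simp only [hS, Finset.coe_filter, Finset.mem_filter, Finset.mem_product,
            Set.mem_ofPred_eq] at hw ⊢
          exact ⟨hw.1.1.1, by rw [hw.2.2, hz.2.2]⟩
        · intro w hw w' hw' h
          simp only [Finset.coe_filter, Set.mem_ofPred_eq] at hw hw'
          exact Prod.ext h (by rw [hw.2.1, hw'.2.1])
    have hsub : (S.filter fun z => z.2 = q) ⊆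
        (S.filter fun z => z.2 = q ∧ φ z.1 = φ q + (-1)) ∪
        ((S.filter fun z => z.2 = q ∧ φ z.1 = φ q + 0) ∪
        (S.filter fun z => z.2 = q ∧ φ z.1 = φ q + 1)) := by
      intro z hz
      simp only [Finset.mem_union, Finset.mem_filter] at hz ⊢
      have h1 : |φ z.2 - φ z.1| ≤ 1 := by
        have := hz.1
        simp only [hS, Finset.mem_filter] at this
        exact this.2.2
      rw [hz.2, abs_le] at h1
      have : φ z.1 = φ q + (-1) ∨ φ z.1 = φ q + 0 ∨ φ z.1 = φ q + 1 := by omega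
      tauto
    have h1 := (Finset.card_le_card hsub).trans ((Finset.card_union_le _ _).trans
      (Nat.add_le_add_left (Finset.card_union_le _ _) _))
    have h2 : (((S.filter fun z => z.2 = q).card : ℕ) : ℝ) ≤
        (((S.filter fun z => z.2 = q ∧ φ z.1 = φ q + (-1)).card : ℕ) : ℝ) +
        ((((S.filter fun z => z.2 = q ∧ φ z.1 = φ q + 0).card : ℕ) : ℝ) +
        (((S.filter fun z => z.2 = q ∧ φ z.1 = φ q + 1).card : ℕ) : ℝ)) := by exact_mod_cast h1
    linarith [hε (-1), hε 0, hε 1]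
  rw [hfib]
  push_cast
  calc ∑ q ∈ G, (((S.filter fun z => z.2 = q).card : ℕ) : ℝ) ≤ ∑ _q ∈ G, 3 * T :=
        Finset.sum_le_sum hq
    _ = 3 * T * G.card := by rw [Finset.sum_const, nsmul_eq_mul]; ring

/-- The number of values of `φ` on `G` with a fibre of more than `T` elements is at most
`|G| / T`. -/
theorem card_rich_mul_le {α : Type*} (G : Finset α) (φ : α → ℤ) (T : ℝ) :
    ((((G.image φ).filter fun d => T < ((G.filter fun p => φ p = d).card : ℝ)).card : ℕ) : ℝ) * T
      ≤ G.card := by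
  classical
  set D := (G.image φ).filter fun d => T < ((G.filter fun p => φ p = d).card : ℝ)
  have h1 : G.card = ∑ d ∈ G.image φ, (G.filter fun p => φ p = d).card :=
    Finset.card_eq_sum_card_image φ G
  calc (D.card : ℝ) * T = ∑ _d ∈ D, T := by rw [Finset.sum_const, nsmul_eq_mul]
    _ ≤ ∑ d ∈ D, ((G.filter fun p => φ p = d).card : ℝ) :=
        Finset.sum_le_sum fun d hd => (Finset.mem_filter.1 hd).2.le
    _ ≤ ∑ d ∈ G.image φ, ((G.filter fun p => φ p = d).card : ℝ) :=
        Finset.sum_le_sum_of_subset_of_nonneg (Finset.filter_subset _ _)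
          fun _ _ _ => Nat.cast_nonneg _
    _ = G.card := by rw [h1]; push_cast; rfl

/-- The discrete form of the vertex problem: the number of (doubled) centres `(i + i', j + j')` of
approximate squares with vertices in the grid `P × Q` is at most
`6 |P| |Q| T + 9 (|P| |Q| / T)²`. Centres for which one of the four vertices lies on a diagonal
with at most `T` points are counted by pairs of opposite vertices; the other centres are
intersection points of rich diagonals. -/
theorem card_centers_le (P Q : Finset ℤ) (E : Finset (ℤ × ℤ)) {T : ℝ} (hT : 0 < T)
    (hE : ∀ c ∈ E, ∃ i ∈ P, ∃ i' ∈ P, ∃ j ∈ Q, ∃ j' ∈ Q,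
      |(i' - i) - (j' - j)| ≤ 1 ∧ c = (i + i', j + j')) :
    (E.card : ℝ) ≤ 6 * T * (P.card * Q.card) + 9 * ((P.card * Q.card) / T) ^ 2 := by
  classical
  set G := P ×ˢ Q with hG
  have hGc : (G.card : ℝ) = P.card * Q.card := by rw [hG, Finset.card_product]; push_cast; rfl
  let φ : ℤ × ℤ → ℤ := fun p => p.1 - p.2
  let ψ : ℤ × ℤ → ℤ := fun p => p.1 + p.2
  let poor : (ℤ × ℤ → ℤ) → Finset ((ℤ × ℤ) × (ℤ × ℤ)) := fun f =>
    (G ×ˢ G).filter fun z => ((G.filter fun p => f p = f z.1).card : ℝ) ≤ T ∧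
      |f z.2 - f z.1| ≤ 1
  let rich : (ℤ × ℤ → ℤ) → Finset ℤ := fun f =>
    (G.image f).filter fun d => T < ((G.filter fun p => f p = d).card : ℝ)
  let I : Finset ℤ := {-1, 0, 1}
  let R : (ℤ × ℤ → ℤ) → Finset ℤ := fun f => (rich f ×ˢ I).image fun z => 2 * z.1 + z.2
  let E₃ := E.filter fun c => c.1 - c.2 ∈ R φ ∧ c.1 + c.2 ∈ R ψ
  have hdich : ∀ f : ℤ × ℤ → ℤ, ∀ p ∈ G, ∀ q ∈ G, |f q - f p| ≤ 1 →
      p + q ∈ (poor f).image (fun z => z.1 + z.2) ∨ f p + f q ∈ R f := by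
    intro f p hp q hq hpq
    by_cases h : ((G.filter fun x => f x = f p).card : ℝ) ≤ T
    · left
      exact Finset.mem_image.2 ⟨(p, q), Finset.mem_filter.2
        ⟨Finset.mem_product.2 ⟨hp, hq⟩, h, hpq⟩, rfl⟩
    · right
      refine Finset.mem_image.2 ⟨(f p, f q - f p), Finset.mem_product.2
        ⟨Finset.mem_filter.2 ⟨Finset.mem_image_of_mem _ hp, not_le.1 h⟩, ?_⟩, ?_⟩
      · rw [abs_le] at hpq
        simp only [I, Finset.mem_insert, Finset.mem_singleton]
        omega
      · dsimp only; ring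
  -- both pairs of opposite vertices of a square have the sum `c`
  have hsub : E ⊆ ((poor φ).image fun z => z.1 + z.2) ∪
      (((poor ψ).image fun z => z.1 + z.2) ∪ E₃) := by
    intro c hc
    obtain ⟨i, hi, i', hi', j, hj, j', hj', hd, rfl⟩ := hE c hc
    have m : ∀ {x y}, x ∈ P → y ∈ Q → (x, y) ∈ G := fun hx hy => Finset.mem_product.2 ⟨hx, hy⟩
    have h1 := hdich φ (i, j) (m hi hj) (i', j') (m hi' hj')
      (by dsimp only [φ]; rw [abs_le] at hd ⊢; omega)
    have h2 := hdich ψ (i', j) (m hi' hj) (i, j') (m hi hj')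
      (by dsimp only [ψ]; rw [abs_le] at hd ⊢; omega)
    have e2 : ((i', j) : ℤ × ℤ) + (i, j') = (i + i', j + j') := by
      ext <;> simp [add_comm]
    have e1 : ((i, j) : ℤ × ℤ) + (i', j') = (i + i', j + j') := rfl
    have e3 : φ (i, j) + φ (i', j') = (i + i') - (j + j') := by dsimp only [φ]; ring
    have e4 : ψ (i', j) + ψ (i, j') = (i + i') + (j + j') := by dsimp only [ψ]; ring
    rw [e1, e3] at h1
    rw [e2, e4] at h2
    rw [Finset.mem_union, Finset.mem_union]
    rcases h1 with h1 | h1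
    · exact Or.inl h1
    rcases h2 with h2 | h2
    · exact Or.inr (Or.inl h2)
    · exact Or.inr (Or.inr (Finset.mem_filter.2 ⟨hc, h1, h2⟩))
  have hpoor : ∀ f, ((((poor f).image fun z => z.1 + z.2).card : ℕ) : ℝ) ≤ 3 * T * G.card :=
    fun f => le_trans (by exact_mod_cast Finset.card_image_le) (card_pairs_poor_le G f T hT.le)
  have hR : ∀ f, ((R f).card : ℝ) ≤ 3 * (G.card / T) := by
    intro f
    have h1 : ((R f).card : ℝ) ≤ (rich f).card * 3 := by
      have : (R f).card ≤ (rich f).card * 3 := by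
        refine Finset.card_image_le.trans ?_
        rw [Finset.card_product]
        exact Nat.mul_le_mul_left _ (by decide)
      exact_mod_cast this
    have h2 : ((rich f).card : ℝ) ≤ G.card / T := (le_div_iff₀ hT).2 (card_rich_mul_le G f T)
    linarith
  have hE₃ : (E₃.card : ℝ) ≤ 9 * (G.card / T) ^ 2 := by
    have h1 : E₃.card ≤ (R φ ×ˢ R ψ).card := by
      refine Finset.card_le_card_of_injOn (fun c => (c.1 - c.2, c.1 + c.2)) ?_ ?_
      · intro c hc
        exact Finset.mem_product.2 (Finset.mem_filter.1 hc).2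
      · intro c _ c' _ h
        simp only [Prod.mk.injEq] at h
        ext <;> omega
    rw [Finset.card_product] at h1
    have h2 : (E₃.card : ℝ) ≤ (R φ).card * (R ψ).card := by exact_mod_cast h1
    have h3 : ((R φ).card : ℝ) * (R ψ).card ≤ (3 * (G.card / T)) * (3 * (G.card / T)) :=
      mul_le_mul (hR φ) (hR ψ) (Nat.cast_nonneg _) (by positivity)
    nlinarith
  have h := (Finset.card_le_card hsub).trans ((Finset.card_union_le _ _).trans
      (Nat.add_le_add_left (Finset.card_union_le _ _) _))
  have h' : (E.card : ℝ) ≤ (((poor φ).image fun z => z.1 + z.2).card : ℝ) +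
      ((((poor ψ).image fun z => z.1 + z.2).card : ℝ) + E₃.card) := by exact_mod_cast h
  rw [← hGc]
  linarith [hpoor φ, hpoor ψ]

/-! ### Rows and columns of a cover -/

/-- If every number in the cells `i ∈ P` of the `δ`-grid is the abscissa of a vertical segment of
length `ℓ`, then covering these segments by boxes of side `2δ` takes at least `|P| ⌊ℓ/δ⌋ / 9`
boxes. The centres of the boxes are `(u c, v c)` for `c ∈ C`. -/
theorem card_cells_mul_le {ι : Type*} {δ ℓ : ℝ} (hδ : 0 < δ) (C : Finset ι) (u v : ι → ℝ)
    (U : Set ℝ) (hU : ∀ x ∈ U, ∃ p, ∀ y ∈ Icc p (p + ℓ), ∃ c ∈ C, |x - u c| ≤ δ ∧ |y - v c| ≤ δ)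
    (P : Finset ℤ) (hP : ∀ i ∈ P, ∃ x ∈ U, ⌊x / δ⌋ = i) :
    P.card * ⌊ℓ / δ⌋₊ ≤ 9 * C.card := by
  classical
  -- the values at indices outside `P` play no role
  have hP' : ∀ i : ℤ, ∃ x p : ℝ, i ∈ P → ⌊x / δ⌋ = i ∧
      ∀ y ∈ Icc p (p + ℓ), ∃ c ∈ C, |x - u c| ≤ δ ∧ |y - v c| ≤ δ := by
    intro i
    by_cases hi : i ∈ P
    · obtain ⟨x, hx, hxi⟩ := hP i hi
      obtain ⟨p, hp⟩ := hU x hx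
      exact ⟨x, p, fun _ => ⟨hxi, hp⟩⟩
    · exact ⟨0, 0, fun h => absurd h hi⟩
  choose x p hxp using hP'
  let k : ℤ × ℕ → ℤ := fun z => ⌈p z.1 / δ⌉ + z.2
  set S := P ×ˢ Finset.range ⌊ℓ / δ⌋₊ with hS
  -- the box that covers the `t`-th point of the segment over the cell `i`
  have hc : ∀ z ∈ S, ∃ c ∈ C, |x z.1 - u c| ≤ δ ∧ |k z * δ - v c| ≤ δ := by
    rintro ⟨i, t⟩ hz
    have hz' := Finset.mem_product.1 hz
    have ht : t + 1 ≤ ⌊ℓ / δ⌋₊ := Finset.mem_range.1 hz'.2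
    have ht' : (t : ℝ) + 1 ≤ ℓ / δ := by
      have h0 : 0 ≤ ℓ / δ := by
        by_contra h
        rw [Nat.floor_of_nonpos (not_le.1 h).le] at ht
        omega
      calc (t : ℝ) + 1 ≤ ⌊ℓ / δ⌋₊ := by exact_mod_cast ht
        _ ≤ ℓ / δ := Nat.floor_le h0
    obtain ⟨c, hc, h1, h2⟩ := (hxp i hz'.1).2 (k (i, t) * δ) (by
      have h1 := Int.le_ceil (p i / δ)
      have h2 := Int.ceil_lt_add_one (p i / δ)
      rw [div_le_iff₀ hδ] at h1
      have h3 : (⌈p i / δ⌉ : ℝ) * δ < p i + δ := by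
        calc (⌈p i / δ⌉ : ℝ) * δ < (p i / δ + 1) * δ := by gcongr
          _ = p i + δ := by field_simp
      rw [le_div_iff₀ hδ] at ht'
      have h4 : (0 : ℝ) ≤ t * δ := by positivity
      simp only [k]
      push_cast
      constructor <;> nlinarith)
    exact ⟨c, hc, h1, h2⟩
  rcases S.eq_empty_or_nonempty with hSe | ⟨z₀, hz₀⟩
  · have : S.card = P.card * ⌊ℓ / δ⌋₊ := by rw [hS, Finset.card_product, Finset.card_range]
    rw [← this, hSe]
    exact Nat.zero_le _
  have : Nonempty ι := ⟨(hc z₀ hz₀).choose⟩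
  choose! g hg using hc
  have hfl : ∀ s w : ℝ, |s - w| ≤ δ → ⌊s / δ⌋ ∈ Finset.Icc (⌊w / δ⌋ - 1) (⌊w / δ⌋ + 1) := by
    intro s w h
    rw [abs_le] at h
    have h1 : s / δ ≤ w / δ + 1 := by
      rw [div_add_one hδ.ne']; gcongr; linarith
    have h2 : w / δ - 1 ≤ s / δ := by
      rw [div_sub_one hδ.ne']; gcongr; linarith
    rw [Finset.mem_Icc]
    constructor
    · have := Int.floor_le_floor h2
      rwa [Int.floor_sub_one] at this
    · have := Int.floor_le_floor h1
      rwa [Int.floor_add_one] at this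
  have key := Finset.card_le_mul_card_image_of_maps_to (s := S) (t := C) (f := g)
    (fun z hz => (hg z hz).1) 9 (by
      intro c _
      have hcard : ∀ m : ℤ, (Finset.Icc (m - 1) (m + 1)).card = 3 := by
        intro m; rw [Int.card_Icc]; omega
      calc (S.filter fun z => g z = c).card
          ≤ (Finset.Icc (⌊u c / δ⌋ - 1) (⌊u c / δ⌋ + 1) ×ˢ
              Finset.Icc (⌊v c / δ⌋ - 1) (⌊v c / δ⌋ + 1)).card := by
            refine Finset.card_le_card_of_injOn (fun z => (z.1, k z)) ?_ ?_
            · intro z hz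
              obtain ⟨hzS, rfl⟩ := Finset.mem_filter.1 hz
              obtain ⟨_, h1, h2⟩ := hg z hzS
              refine Finset.mem_product.2 ⟨?_, ?_⟩
              · have := hfl _ _ h1
                rwa [(hxp z.1 (Finset.mem_product.1 hzS).1).1] at this
              · have := hfl _ _ h2
                rwa [mul_div_cancel_right₀ _ hδ.ne', Int.floor_intCast] at this
            · rintro ⟨i, t⟩ _ ⟨i', t'⟩ _ h
              simp only [Prod.mk.injEq, k] at h
              obtain ⟨rfl, h⟩ := h
              simpa using h
        _ = 9 := by rw [Finset.card_product, hcard, hcard])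
  rwa [hS, Finset.card_product, Finset.card_range] at key

/-- The finite set of all cells that meet `U`, in the situation of `card_cells_mul_le`. -/
theorem exists_cells {ι : Type*} {δ ℓ : ℝ} (hδ : 0 < δ) (hδℓ : 2 * δ ≤ ℓ) (C : Finset ι)
    (u v : ι → ℝ) (U : Set ℝ)
    (hU : ∀ x ∈ U, ∃ p, ∀ y ∈ Icc p (p + ℓ), ∃ c ∈ C, |x - u c| ≤ δ ∧ |y - v c| ≤ δ) :
    ∃ P : Finset ℤ, (∀ x ∈ U, ⌊x / δ⌋ ∈ P) ∧ (P.card : ℝ) ≤ 18 * δ / ℓ * C.card := by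
  have hℓ : 0 < ℓ := by linarith
  have h2 : 2 ≤ ℓ / δ := by rwa [le_div_iff₀ hδ]
  have hm : ℓ / δ / 2 ≤ ⌊ℓ / δ⌋₊ := by
    have := Nat.lt_floor_add_one (ℓ / δ)
    linarith
  have hm1 : 1 ≤ ⌊ℓ / δ⌋₊ := Nat.le_floor (by push_cast; linarith)
  have hfin : ((fun x : ℝ => ⌊x / δ⌋) '' U).Finite := by
    by_contra hinf
    obtain ⟨P, hPU, hPc⟩ := Set.Infinite.exists_subset_card_eq hinf (9 * C.card + 1)
    have := card_cells_mul_le hδ C u v U hU P (fun i hi => hPU hi)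
    rw [hPc] at this
    nlinarith
  refine ⟨hfin.toFinset, fun x hx => hfin.mem_toFinset.2 ⟨x, hx, rfl⟩, ?_⟩
  have h := card_cells_mul_le hδ C u v U hU hfin.toFinset (fun i hi => hfin.mem_toFinset.1 hi)
  have h' : (hfin.toFinset.card : ℝ) * ⌊ℓ / δ⌋₊ ≤ 9 * C.card := by exact_mod_cast h
  have h3 : (hfin.toFinset.card : ℝ) * (ℓ / δ / 2) ≤ 9 * C.card :=
    (mul_le_mul_of_nonneg_left hm (Nat.cast_nonneg _)).trans h'
  rw [div_mul_eq_mul_div, le_div_iff₀ hℓ]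
  calc (hfin.toFinset.card : ℝ) * ℓ = 2 * δ * (hfin.toFinset.card * (ℓ / δ / 2)) := by
        field_simp
    _ ≤ 2 * δ * (9 * C.card) := by gcongr
    _ = 18 * δ * C.card := by ring

/-! ### The area of the set of centres -/

/-- The abscissae of the vertical segments of length `ℓ` contained in `F`. -/
def longCols (F : Set Plane) (ℓ : ℝ) : Set ℝ :=
  {x | ∃ p, ∀ y ∈ Icc p (p + ℓ), !₂[x, y] ∈ F}

/-- The ordinates of the horizontal segments of length `ℓ` contained in `F`. -/
def longRows (F : Set Plane) (ℓ : ℝ) : Set ℝ :=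
  {y | ∃ p, ∀ x ∈ Icc p (p + ℓ), !₂[x, y] ∈ F}

/-- The centres of the squares whose four side lines each contain a segment of length `ℓ` lying
in `F`. Only the lines matter, and the centre is a point of `ℝ × ℝ`, where areas of rectangles are
products. -/
def lineSquareCenters (F : Set Plane) (ℓ : ℝ) : Set (ℝ × ℝ) :=
  {c | ∃ r, c.1 - r ∈ longCols F ℓ ∧ c.1 + r ∈ longCols F ℓ ∧
    c.2 - r ∈ longRows F ℓ ∧ c.2 + r ∈ longRows F ℓ}

/-- If the columns and rows of `F` lie in at most `M` cells of the `δ`-grid each, then the centres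
lie in `O(M ^ (8/3))` squares of side `δ`. -/
theorem volume_lineSquareCenters_le {F : Set Plane} {ℓ δ M : ℝ} (hδ : 0 < δ) (hM : 0 < M)
    (P Q : Finset ℤ) (hP : ∀ x ∈ longCols F ℓ, ⌊x / δ⌋ ∈ P) (hQ : ∀ y ∈ longRows F ℓ, ⌊y / δ⌋ ∈ Q)
    (hPM : (P.card : ℝ) ≤ M) (hQM : (Q.card : ℝ) ≤ M) :
    MeasureTheory.volume (lineSquareCenters F ℓ) ≤
      ENNReal.ofReal (15 * M ^ (8 / 3 : ℝ) * δ ^ 2) := by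
  classical
  set E : Finset (ℤ × ℤ) := (((P ×ˢ P) ×ˢ (Q ×ˢ Q)).filter fun z =>
    |(z.1.2 - z.1.1) - (z.2.2 - z.2.1)| ≤ 1).image fun z => (z.1.1 + z.1.2, z.2.1 + z.2.2) with hE
  -- this threshold balances the two terms in `card_centers_le`
  have hT : 0 < M ^ (2 / 3 : ℝ) := Real.rpow_pos_of_pos hM _
  have hEc : (E.card : ℝ) ≤ 15 * M ^ (8 / 3 : ℝ) := by
    have h := card_centers_le P Q E hT (by
      intro c hc
      obtain ⟨⟨⟨i, i'⟩, j, j'⟩, hz, rfl⟩ := Finset.mem_image.1 hc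
      simp only [Finset.mem_filter, Finset.mem_product] at hz
      exact ⟨i, hz.1.1.1, i', hz.1.1.2, j, hz.1.2.1, j', hz.1.2.2, hz.2, rfl⟩)
    have h1 : (P.card : ℝ) * Q.card ≤ M ^ 2 := by
      rw [sq]
      exact mul_le_mul hPM hQM (Nat.cast_nonneg _) hM.le
    have h2 : M ^ (2 / 3 : ℝ) * M ^ 2 = M ^ (8 / 3 : ℝ) := by
      rw [← Real.rpow_natCast M 2, ← Real.rpow_add hM]; norm_num
    have h3 : (M ^ 2 / M ^ (2 / 3 : ℝ)) ^ 2 = M ^ (8 / 3 : ℝ) := by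
      rw [← Real.rpow_natCast M 2, ← Real.rpow_sub hM, ← Real.rpow_natCast, ← Real.rpow_mul hM.le]
      norm_num
    calc (E.card : ℝ) ≤ _ := h
      _ ≤ 6 * M ^ (2 / 3 : ℝ) * M ^ 2 + 9 * (M ^ 2 / M ^ (2 / 3 : ℝ)) ^ 2 := by gcongr
      _ = 15 * M ^ (8 / 3 : ℝ) := by rw [mul_assoc, h2, h3]; ring
  have hsub : lineSquareCenters F ℓ ⊆ ⋃ e ∈ E, Icc (e.1 * δ / 2) (e.1 * δ / 2 + δ) ×ˢ
      Icc (e.2 * δ / 2) (e.2 * δ / 2 + δ) := by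
    rintro ⟨a, b⟩ ⟨r, h1, h2, h3, h4⟩
    dsimp only at h1 h2 h3 h4
    have hfl : ∀ x : ℝ, ⌊x / δ⌋ * δ ≤ x ∧ x < ⌊x / δ⌋ * δ + δ := by
      intro x
      constructor
      · rw [← le_div_iff₀ hδ]; exact Int.floor_le _
      · rw [← add_one_mul, ← div_lt_iff₀ hδ]; exact Int.lt_floor_add_one _
    obtain ⟨l1, u1⟩ := hfl (a - r)
    obtain ⟨l2, u2⟩ := hfl (a + r)
    obtain ⟨l3, u3⟩ := hfl (b - r)
    obtain ⟨l4, u4⟩ := hfl (b + r)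
    have hi1 := hP _ h1
    have hi2 := hP _ h2
    have hi3 := hQ _ h3
    have hi4 := hQ _ h4
    generalize ⌊(a - r) / δ⌋ = i at *
    generalize ⌊(a + r) / δ⌋ = i' at *
    generalize ⌊(b - r) / δ⌋ = j at *
    generalize ⌊(b + r) / δ⌋ = j' at *
    -- both side lengths are `2 r`, and rounding changes each of them by less than one unit
    have hdiff : |(i' - i) - (j' - j)| ≤ 1 := by
      have e1 : (((i' - i) - (j' - j) : ℤ) : ℝ) * δ < 2 * δ := by push_cast; linarith
      have e2 : (-2 : ℝ) * δ < (((i' - i) - (j' - j) : ℤ) : ℝ) * δ := by push_cast; linarith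
      have e1' := lt_of_mul_lt_mul_right e1 hδ.le
      have e2' := lt_of_mul_lt_mul_right e2 hδ.le
      have f1 : (i' - i) - (j' - j) < 2 := by exact_mod_cast e1'
      have f2 : -2 < (i' - i) - (j' - j) := by exact_mod_cast e2'
      rw [abs_le]; omega
    refine mem_iUnion₂.2 ⟨(i + i', j + j'), ?_, ?_⟩
    · exact Finset.mem_image.2 ⟨((i, i'), (j, j')), by
        simp only [Finset.mem_filter, Finset.mem_product]
        exact ⟨⟨⟨hi1, hi2⟩, hi3, hi4⟩, hdiff⟩, rfl⟩
    · simp only [mem_prod, mem_Icc]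
      push_cast
      refine ⟨⟨?_, ?_⟩, ?_, ?_⟩ <;> linarith
  calc MeasureTheory.volume (lineSquareCenters F ℓ)
      ≤ MeasureTheory.volume (⋃ e ∈ E, Icc ((e.1 : ℝ) * δ / 2) (e.1 * δ / 2 + δ) ×ˢ
          Icc ((e.2 : ℝ) * δ / 2) (e.2 * δ / 2 + δ)) := MeasureTheory.measure_mono hsub
    _ ≤ ∑ e ∈ E, MeasureTheory.volume (Icc ((e.1 : ℝ) * δ / 2) (e.1 * δ / 2 + δ) ×ˢ
          Icc ((e.2 : ℝ) * δ / 2) (e.2 * δ / 2 + δ)) := MeasureTheory.measure_biUnion_finset_le _ _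
    _ = ∑ _e ∈ E, ENNReal.ofReal (δ ^ 2) := by
        refine Finset.sum_congr rfl fun e _ => ?_
        rw [MeasureTheory.Measure.volume_eq_prod, MeasureTheory.Measure.prod_prod,
          Real.volume_Icc, Real.volume_Icc, add_sub_cancel_left, add_sub_cancel_left,
          ← ENNReal.ofReal_mul hδ.le, sq]
    _ = ENNReal.ofReal (E.card * δ ^ 2) := by
        rw [Finset.sum_const, nsmul_eq_mul, ENNReal.ofReal_mul (Nat.cast_nonneg _),
          ENNReal.ofReal_natCast]
    _ ≤ ENNReal.ofReal (15 * M ^ (8 / 3 : ℝ) * δ ^ 2) := by gcongr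

theorem volume_lineSquareCenters_le_of_cover {F : Set Plane} {ℓ : ℝ} {δ : ℝ≥0} (hδ : 0 < δ)
    (hδℓ : 2 * (δ : ℝ) ≤ ℓ) {C : Finset Plane} (hC : Metric.IsCover δ F C) (hne : C.Nonempty) :
    MeasureTheory.volume (lineSquareCenters F ℓ) ≤
      ENNReal.ofReal (15 * (18 * δ / ℓ * C.card) ^ (8 / 3 : ℝ) * (δ : ℝ) ^ 2) := by
  have hδ' : (0 : ℝ) < δ := hδ
  have hcov : ∀ x y : ℝ, !₂[x, y] ∈ F → ∃ c ∈ C, |x - c 0| ≤ δ ∧ |y - c 1| ≤ δ := by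
    intro x y hxy
    have h := Metric.isCover_iff_subset_iUnion_closedBall.1 hC hxy
    obtain ⟨c, hc, hd⟩ := mem_iUnion₂.1 h
    rw [Metric.mem_closedBall, dist_eq_norm] at hd
    have h0 := (PiLp.norm_apply_le (!₂[x, y] - c) 0).trans hd
    have h1 := (PiLp.norm_apply_le (!₂[x, y] - c) 1).trans hd
    exact ⟨c, hc, by simpa using h0, by simpa using h1⟩
  obtain ⟨P, hP, hPc⟩ := exists_cells hδ' hδℓ C (fun c => c 0) (fun c => c 1) (longCols F ℓ)
    (fun x ⟨p, hp⟩ => ⟨p, fun y hy => hcov x y (hp y hy)⟩)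
  obtain ⟨Q, hQ, hQc⟩ := exists_cells hδ' hδℓ C (fun c => c 1) (fun c => c 0) (longRows F ℓ)
    (fun y ⟨p, hp⟩ => ⟨p, fun x hx => by
      obtain ⟨c, hc, h1, h2⟩ := hcov x y (hp x hx)
      exact ⟨c, hc, h2, h1⟩⟩)
  have hcard : (0 : ℝ) < C.card := by exact_mod_cast hne.card_pos
  have hℓ : 0 < ℓ := by linarith
  exact volume_lineSquareCenters_le hδ' (by positivity) P Q hP hQ hPc hQc

/-- A set with a positive area of centres has covering numbers at least `c δ ^ (-7/4)`. -/
theorem exists_le_externalCoveringNumber {F : Set Plane} {ℓ : ℝ} (hℓ : 0 < ℓ)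
    (hF : MeasureTheory.volume (lineSquareCenters F ℓ) ≠ 0) :
    ∃ c : ℝ, 0 < c ∧ ∀ δ : ℝ≥0, 0 < δ → 2 * (δ : ℝ) ≤ ℓ →
      ENNReal.ofReal (c * (δ : ℝ) ^ (-(7 / 4) : ℝ)) ≤
        (Metric.externalCoveringNumber δ F : ℝ≥0∞) := by
  -- truncated, as the area might be infinite
  set w := min (MeasureTheory.volume (lineSquareCenters F ℓ)) 1 with hw
  have hwtop : w ≠ ⊤ := ne_top_of_le_ne_top ENNReal.one_ne_top (min_le_right _ _)
  have hw0 : w ≠ 0 := by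
    rw [hw]; exact (lt_min (pos_iff_ne_zero.2 hF) one_pos).ne'
  set a := w.toReal
  have ha : 0 < a := ENNReal.toReal_pos hw0 hwtop
  refine ⟨ℓ / 18 * (a / 15) ^ (3 / 8 : ℝ), by positivity, fun δ hδ hδℓ => ?_⟩
  have hδ' : (0 : ℝ) < δ := hδ
  have hFne : F.Nonempty := by
    rw [nonempty_iff_ne_empty]
    rintro rfl
    apply hF
    have : lineSquareCenters ∅ ℓ = ∅ := by
      ext ⟨x, y⟩
      simp only [mem_empty_iff_false, iff_false]
      rintro ⟨r, ⟨p, hp⟩, -⟩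
      exact hp p ⟨le_rfl, by linarith⟩
    rw [this, MeasureTheory.measure_empty]
  rw [Metric.externalCoveringNumber]
  rw [ENat.toENNReal_iInf]
  refine le_iInf fun C => ?_
  rw [ENat.toENNReal_iInf]
  refine le_iInf fun hC => ?_
  by_cases hfin : C.Finite
  swap
  · rw [Set.Infinite.encard_eq hfin]; simp
  lift C to Finset Plane using hfin
  have hCne : C.Nonempty := by exact_mod_cast hC.nonempty hFne
  have h := volume_lineSquareCenters_le_of_cover hδ hδℓ hC hCne
  have h1 : a ≤ 15 * (18 * δ / ℓ * C.card) ^ (8 / 3 : ℝ) * (δ : ℝ) ^ 2 := by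
    refine ENNReal.toReal_le_of_le_ofReal (by positivity) ?_
    exact (min_le_left _ _).trans h
  rw [Set.encard_coe_eq_coe_finsetCard, ENat.toENNReal_coe, ← ENNReal.ofReal_natCast]
  refine ENNReal.ofReal_le_ofReal ?_
  have h2 : a / 15 ≤ (18 * δ / ℓ * C.card) ^ (8 / 3 : ℝ) * (δ : ℝ) ^ 2 := by
    rw [div_le_iff₀ (by norm_num)]; linarith
  have h3 : (a / 15) ^ (3 / 8 : ℝ) ≤ (18 * δ / ℓ * C.card) * (δ : ℝ) ^ (3 / 4 : ℝ) := by
    calc (a / 15) ^ (3 / 8 : ℝ)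
        ≤ ((18 * δ / ℓ * C.card) ^ (8 / 3 : ℝ) * (δ : ℝ) ^ 2) ^ (3 / 8 : ℝ) := by gcongr
      _ = _ := by
        rw [Real.mul_rpow (by positivity) (by positivity), ← Real.rpow_mul (by positivity),
          ← Real.rpow_natCast (δ : ℝ) 2, ← Real.rpow_mul hδ'.le]
        norm_num
  have h4 : (δ : ℝ) * (δ : ℝ) ^ (3 / 4 : ℝ) * (δ : ℝ) ^ (-(7 / 4) : ℝ) = 1 := by
    nth_rewrite 1 [← Real.rpow_one (δ : ℝ)]
    rw [← Real.rpow_add hδ', ← Real.rpow_add hδ']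
    norm_num
  calc ℓ / 18 * (a / 15) ^ (3 / 8 : ℝ) * (δ : ℝ) ^ (-(7 / 4) : ℝ)
      ≤ ℓ / 18 * ((18 * δ / ℓ * C.card) * (δ : ℝ) ^ (3 / 4 : ℝ)) * (δ : ℝ) ^ (-(7 / 4) : ℝ) := by
        gcongr
    _ = C.card * ((δ : ℝ) * (δ : ℝ) ^ (3 / 4 : ℝ) * (δ : ℝ) ^ (-(7 / 4) : ℝ)) := by
        field_simp
    _ = C.card := by rw [h4, mul_one]

/-! ### Long segments in a countable closed cover -/

theorem longCols_mono {F F' : Set Plane} {ℓ ℓ' : ℝ} (hF : F ⊆ F') (hℓ : ℓ' ≤ ℓ) :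
    longCols F ℓ ⊆ longCols F' ℓ' :=
  fun _ ⟨p, hp⟩ => ⟨p, fun y hy => hF (hp y ⟨hy.1, by linarith [hy.2]⟩)⟩

theorem longRows_mono {F F' : Set Plane} {ℓ ℓ' : ℝ} (hF : F ⊆ F') (hℓ : ℓ' ≤ ℓ) :
    longRows F ℓ ⊆ longRows F' ℓ' :=
  fun _ ⟨p, hp⟩ => ⟨p, fun y hy => hF (hp y ⟨hy.1, by linarith [hy.2]⟩)⟩

/-- A consequence of the Baire category theorem: if a curve over an interval is covered by
countably many closed sets, then one of them contains the part of it over a smaller interval. -/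
theorem exists_Icc_maps_to_of_iUnion_closed {X : Type*} [TopologicalSpace X] {G : ℕ → Set X}
    (hG : ∀ n, IsClosed (G n)) {f : ℝ → X} (hf : Continuous f) {s t : ℝ} (hst : s < t)
    (hcov : ∀ y ∈ Icc s t, f y ∈ ⋃ n, G n) :
    ∃ n p ℓ, 0 < ℓ ∧ ∀ y ∈ Icc p (p + ℓ), f y ∈ G n := by
  -- the extra closed set covers the complement of the interval
  let K : Option ℕ → Set ℝ := fun o => o.elim (Ioo s t)ᶜ fun n => f ⁻¹' G n
  have hK : ∀ o, IsClosed (K o) := by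
    rintro (_ | n)
    · exact isOpen_Ioo.isClosed_compl
    · exact (hG n).preimage hf
  have hKU : ⋃ o, K o = univ := by
    refine eq_univ_of_forall fun y => ?_
    by_cases hy : y ∈ Ioo s t
    · obtain ⟨n, hn⟩ := mem_iUnion.1 (hcov y (Ioo_subset_Icc_self hy))
      exact mem_iUnion.2 ⟨some n, hn⟩
    · exact mem_iUnion.2 ⟨none, hy⟩
  obtain ⟨y, hy, hyK⟩ := (dense_iUnion_interior_of_closed hK hKU).exists_mem_open isOpen_Ioo
    (nonempty_Ioo.2 hst)
  obtain ⟨o, ho⟩ := mem_iUnion.1 hy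
  rcases o with _ | n
  · exact absurd hyK (interior_subset ho)
  · obtain ⟨ε, hε, hball⟩ := Metric.isOpen_iff.1 isOpen_interior y ho
    refine ⟨n, y, ε / 2, by positivity, fun z hz => ?_⟩
    have : z ∈ Metric.ball y ε := by
      rw [Metric.mem_ball, Real.dist_eq, abs_lt]
      constructor <;> linarith [hz.1, hz.2]
    have hzK : z ∈ K (some n) := interior_subset (hball this)
    exact hzK

/-- If countably many closed sets cover a set that contains squares centred at every point of the
unit square, then finitely many of them already contain, for a set of centres of positive outer
measure, segments of a fixed length on all four sides. -/
theorem exists_volume_lineSquareCenters_ne_zero {B : Set Plane} (hB : ContainsAllSquares B)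
    {G : ℕ → Set Plane} (hG : ∀ n, IsClosed (G n)) (hBG : B ⊆ ⋃ n, G n) :
    ∃ n : ℕ, MeasureTheory.volume
      (lineSquareCenters (⋃ i ∈ Finset.range n, G i) (1 / (n + 1 : ℝ))) ≠ 0 := by
  by_contra! hzero
  have hcov : Icc (0 : ℝ) 1 ×ˢ Icc (0 : ℝ) 1 ⊆
      ⋃ n : ℕ, lineSquareCenters (⋃ i ∈ Finset.range n, G i) (1 / (n + 1 : ℝ)) := by
    rintro ⟨a, b⟩ ⟨ha, hb⟩
    obtain ⟨r, hr, hsq⟩ := hB !₂[a, b] (by simpa using ha) (by simpa using hb)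
    have hmem : ∀ x y, max |x - a| |y - b| = r → !₂[x, y] ∈ ⋃ n, G n := fun x y h =>
      hBG (hsq (by simpa [squareBoundary] using h))
    have hcol : ∀ x, |x - a| = r → ∃ n ℓ, 0 < ℓ ∧ x ∈ longCols (G n) ℓ := by
      intro x hx
      obtain ⟨n, p, ℓ, hℓ, h⟩ := exists_Icc_maps_to_of_iUnion_closed hG
        (f := fun y : ℝ => (!₂[x, y] : Plane)) (by fun_prop)
        (s := b - r) (t := b + r) (by linarith) (fun y hy => hmem x y (by
          rw [hx]
          exact max_eq_left (abs_le.2 ⟨by linarith [hy.1], by linarith [hy.2]⟩)))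
      exact ⟨n, ℓ, hℓ, p, h⟩
    have hrow : ∀ y, |y - b| = r → ∃ n ℓ, 0 < ℓ ∧ y ∈ longRows (G n) ℓ := by
      intro y hy
      obtain ⟨n, p, ℓ, hℓ, h⟩ := exists_Icc_maps_to_of_iUnion_closed hG
        (f := fun x : ℝ => (!₂[x, y] : Plane)) (by fun_prop)
        (s := a - r) (t := a + r) (by linarith) (fun x hx => hmem x y (by
          rw [hy]
          exact max_eq_right (abs_le.2 ⟨by linarith [hx.1], by linarith [hx.2]⟩)))
      exact ⟨n, ℓ, hℓ, p, h⟩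
    have e1 : ∀ z : ℝ, |z - r - z| = r := fun z => by
      rw [sub_right_comm, sub_self, zero_sub, abs_neg, abs_of_pos hr]
    have e2 : ∀ z : ℝ, |z + r - z| = r := fun z => by
      rw [add_sub_cancel_left, abs_of_pos hr]
    obtain ⟨n₁, ℓ₁, hℓ₁, h₁⟩ := hcol (a - r) (e1 a)
    obtain ⟨n₂, ℓ₂, hℓ₂, h₂⟩ := hcol (a + r) (e2 a)
    obtain ⟨n₃, ℓ₃, hℓ₃, h₃⟩ := hrow (b - r) (e1 b)
    obtain ⟨n₄, ℓ₄, hℓ₄, h₄⟩ := hrow (b + r) (e2 b)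
    obtain ⟨m, hm⟩ := exists_nat_one_div_lt (lt_min (lt_min hℓ₁ hℓ₂) (lt_min hℓ₃ hℓ₄))
    simp only [lt_min_iff] at hm
    obtain ⟨⟨hm₁, hm₂⟩, hm₃, hm₄⟩ := hm
    set N := n₁ + n₂ + n₃ + n₄ + m + 1 with hN
    have hGN : ∀ i, i < N → G i ⊆ ⋃ i ∈ Finset.range N, G i := fun i hi =>
      subset_biUnion_of_mem (u := fun i => G i) (Finset.mem_coe.2 (Finset.mem_range.2 hi))
    have hmN : (1 : ℝ) / (N + 1) ≤ 1 / (m + 1) := by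
      apply one_div_le_one_div_of_le (by positivity)
      have : m ≤ N := by omega
      have : (m : ℝ) ≤ N := by exact_mod_cast this
      linarith
    exact mem_iUnion.2 ⟨N, r,
      longCols_mono (hGN _ (by omega)) (hmN.trans hm₁.le) h₁,
      longCols_mono (hGN _ (by omega)) (hmN.trans hm₂.le) h₂,
      longRows_mono (hGN _ (by omega)) (hmN.trans hm₃.le) h₃,
      longRows_mono (hGN _ (by omega)) (hmN.trans hm₄.le) h₄⟩
  have h := MeasureTheory.measure_mono_null hcov (MeasureTheory.measure_iUnion_null hzero)
  rw [MeasureTheory.Measure.volume_eq_prod, MeasureTheory.Measure.prod_prod] at h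
  simp at h

/-! ### Covering numbers -/

section CoveringNumbers

variable {X : Type*}

theorem exists_isCover_encard_eq [PseudoEMetricSpace X] (δ : ℝ≥0) (A : Set X) :
    ∃ C, Metric.IsCover δ A C ∧ C.encard = Metric.externalCoveringNumber δ A := by
  rw [Metric.externalCoveringNumber, iInf_subtype']
  have : Nonempty {C : Set X // Metric.IsCover δ A C} := ⟨⟨A, Metric.IsCover.refl _ _⟩⟩
  obtain ⟨C, hC⟩ := ciInf_mem fun C : {C : Set X // Metric.IsCover δ A C} => C.1.encard
  exact ⟨C.1, C.2, hC⟩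

theorem externalCoveringNumber_union_le [PseudoEMetricSpace X] (δ : ℝ≥0) (A B : Set X) :
    Metric.externalCoveringNumber δ (A ∪ B) ≤
      Metric.externalCoveringNumber δ A + Metric.externalCoveringNumber δ B := by
  obtain ⟨C, hC, hCe⟩ := exists_isCover_encard_eq δ A
  obtain ⟨D, hD, hDe⟩ := exists_isCover_encard_eq δ B
  rw [← hCe, ← hDe]
  refine le_trans (Metric.IsCover.externalCoveringNumber_le_encard (C := C ∪ D) ?_)
    (Set.encard_union_le C D)
  rintro x (hx | hx)
  · obtain ⟨y, hy, h⟩ := hC hx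
    exact ⟨y, Or.inl hy, h⟩
  · obtain ⟨y, hy, h⟩ := hD hx
    exact ⟨y, Or.inr hy, h⟩

theorem externalCoveringNumber_closure_le [PseudoMetricSpace X] (δ : ℝ≥0) (A : Set X) :
    Metric.externalCoveringNumber δ (closure A) ≤ Metric.externalCoveringNumber δ A := by
  obtain ⟨C, hC, hCe⟩ := exists_isCover_encard_eq δ A
  by_cases hfin : C.Finite
  · have h : IsClosed (⋃ y ∈ C, Metric.closedBall y (δ : ℝ)) :=
      hfin.isClosed_biUnion fun _ _ => Metric.isClosed_closedBall
    rw [← hCe]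
    refine Metric.IsCover.externalCoveringNumber_le_encard ?_
    rw [Metric.isCover_iff_subset_iUnion_closedBall] at hC ⊢
    exact h.closure_subset_iff.2 hC
  · rw [← hCe, Set.Infinite.encard_eq hfin]
    exact le_top

end CoveringNumbers

/-! ### Box dimensions and power bounds on covering numbers -/

section BoxDimension

variable {X : Type*} [PseudoEMetricSpace X]

theorem log_ofReal_mul_rpow_div {c t δ : ℝ} (hc : 0 < c) (hδ : 0 < δ) (hδ1 : δ < 1) :
    ENNReal.log (ENNReal.ofReal (c * δ ^ (-t))) / ((-Real.log δ : ℝ) : EReal) =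
      ((Real.log c / -Real.log δ + t : ℝ) : EReal) := by
  have hlog : Real.log δ < 0 := Real.log_neg hδ hδ1
  rw [ENNReal.log_ofReal_of_pos (by positivity), ← EReal.coe_div,
    Real.log_mul hc.ne' (Real.rpow_pos_of_pos hδ _).ne', Real.log_rpow hδ]
  congr 1
  have := hlog.ne
  field_simp
  ring

theorem tendsto_log_div_neg_log (c t : ℝ) :
    Tendsto (fun δ : ℝ≥0 => ((Real.log c / -Real.log (δ : ℝ) + t : ℝ) : EReal)) (𝓝[>] 0)
      (𝓝 (t : EReal)) := by
  rw [EReal.tendsto_coe]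
  have h1 : Tendsto (fun δ : ℝ≥0 => (δ : ℝ)) (𝓝[>] 0) (𝓝[>] 0) := by
    refine tendsto_nhdsWithin_iff.2 ⟨?_, ?_⟩
    · exact (NNReal.continuous_coe.tendsto' 0 0 rfl).mono_left nhdsWithin_le_nhds
    · filter_upwards [self_mem_nhdsWithin] with δ hδ
      exact hδ
  have h2 : Tendsto (fun δ : ℝ≥0 => -Real.log (δ : ℝ)) (𝓝[>] 0) atTop :=
    tendsto_neg_atBot_atTop.comp (Real.tendsto_log_nhdsGT_zero.comp h1)
  simpa using (h2.const_div_atTop (Real.log c)).add_const t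

theorem eventually_nnreal_pos_and_lt {ε : ℝ≥0} (hε : 0 < ε) :
    ∀ᶠ δ : ℝ≥0 in 𝓝[>] 0, 0 < δ ∧ δ < ε :=
  (eventually_mem_nhdsWithin).and (eventually_nhdsWithin_of_eventually_nhds (eventually_lt_nhds hε))

theorem le_lowerBoxDim_of_le {A : Set X} {c t : ℝ} (hc : 0 < c)
    (h : ∀ᶠ δ : ℝ≥0 in 𝓝[>] 0, ENNReal.ofReal (c * (δ : ℝ) ^ (-t)) ≤
      (Metric.externalCoveringNumber δ A : ℝ≥0∞)) : (t : EReal) ≤ lowerBoxDim A := by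
  rw [← (tendsto_log_div_neg_log c t).liminf_eq]
  refine liminf_le_liminf ?_
  filter_upwards [h, eventually_nnreal_pos_and_lt one_pos] with δ hδ ⟨hδ0, hδ1⟩
  have hδ0' : (0 : ℝ) < δ := hδ0
  have hδ1' : (δ : ℝ) < 1 := hδ1
  rw [← log_ofReal_mul_rpow_div hc hδ0' hδ1', boxQuotient]
  refine EReal.div_le_div_right_of_nonneg ?_ (ENNReal.log_monotone hδ)
  exact_mod_cast (neg_pos.2 (Real.log_neg hδ0' hδ1')).le

theorem upperBoxDim_le_of_le {A : Set X} {c t : ℝ} (hc : 0 < c)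
    (h : ∀ᶠ δ : ℝ≥0 in 𝓝[>] 0, (Metric.externalCoveringNumber δ A : ℝ≥0∞) ≤
      ENNReal.ofReal (c * (δ : ℝ) ^ (-t))) : upperBoxDim A ≤ (t : EReal) := by
  rw [← (tendsto_log_div_neg_log c t).limsup_eq]
  refine limsup_le_limsup ?_
  filter_upwards [h, eventually_nnreal_pos_and_lt one_pos] with δ hδ ⟨hδ0, hδ1⟩
  have hδ0' : (0 : ℝ) < δ := hδ0
  have hδ1' : (δ : ℝ) < 1 := hδ1
  rw [← log_ofReal_mul_rpow_div hc hδ0' hδ1', boxQuotient]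
  refine EReal.div_le_div_right_of_nonneg ?_ (ENNReal.log_monotone hδ)
  exact_mod_cast (neg_pos.2 (Real.log_neg hδ0' hδ1')).le

theorem lowerBoxDim_le_upperBoxDim (A : Set X) : lowerBoxDim A ≤ upperBoxDim A :=
  liminf_le_limsup

end BoxDimension

theorem le_lowerBoxDim_of_containsAllSquares {B : Set Plane} (hB : ContainsAllSquares B) :
    ((7 / 4 : ℝ) : EReal) ≤ lowerBoxDim B := by
  obtain ⟨n, hn⟩ := exists_volume_lineSquareCenters_ne_zero hB (G := fun _ => closure B)
    (fun _ => isClosed_closure) (subset_closure.trans (subset_iUnion (fun _ : ℕ => closure B) 0))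
  obtain ⟨c, hc, h⟩ := exists_le_externalCoveringNumber (by positivity) hn
  refine le_lowerBoxDim_of_le hc ?_
  have hε : (0 : ℝ≥0) < 1 / (n + 1) / 2 := by positivity
  filter_upwards [eventually_nnreal_pos_and_lt hε] with δ ⟨hδ0, hδ1⟩
  have hδ1' : (δ : ℝ) < 1 / (n + 1) / 2 := by exact_mod_cast hδ1
  refine (h δ hδ0 (by linarith)).trans ?_
  rw [ENat.toENNReal_le]
  exact (Metric.externalCoveringNumber_mono_set (iUnion₂_subset fun _ _ => subset_rfl)).trans
    (externalCoveringNumber_closure_le δ B)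

/-! ### Packing premeasure and covering numbers -/

section Packing

variable {X : Type*} [PseudoMetricSpace X]

/-- A maximal `2ρ`-separated set is the set of centres of a packing by balls of radius `ρ`, and
it is a `2ρ`-cover. -/
theorem externalCoveringNumber_mul_le_packingPreContent (s : ℝ≥0) {δ : ℝ} {ρ : ℝ≥0} (hρ : 0 < ρ)
    (hρδ : (ρ : ℝ) ≤ δ) (A : Set X) :
    (Metric.externalCoveringNumber (2 * ρ) A : ℝ≥0∞) * ENNReal.ofReal (2 * ρ) ^ (s : ℝ) ≤
      packingPreContent s δ A := by
  have hle : Metric.externalCoveringNumber (2 * ρ) A ≤ Metric.packingNumber (2 * ρ) A :=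
    (Metric.externalCoveringNumber_le_coveringNumber _ _).trans
      (Metric.coveringNumber_le_packingNumber _ _)
  refine (mul_le_mul_left (ENat.toENNReal_le.2 hle) _).trans ?_
  rw [Metric.packingNumber]
  simp only [ENat.toENNReal_iSup, ENNReal.iSup_mul]
  refine iSup_le fun C => iSup_le fun hCA => iSup_le fun hC => ?_
  have hpack : IsBallPacking A δ ((fun x => (x, (ρ : ℝ))) '' C) := by
    refine ⟨?_, ?_⟩
    · rintro _ ⟨x, hx, rfl⟩
      exact ⟨hCA hx, hρ, hρδ⟩
    · rintro _ ⟨x, hx, rfl⟩ _ ⟨y, hy, rfl⟩ hxy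
      have hne : x ≠ y := fun h => hxy (by rw [h])
      have h : ((2 * ρ : ℝ≥0) : ℝ≥0∞) < edist x y := hC hx hy hne
      refine Metric.closedBall_disjoint_closedBall ?_
      rw [edist_dist, ← ENNReal.ofReal_coe_nnreal,
        ENNReal.ofReal_lt_ofReal_iff_of_nonneg (by positivity)] at h
      push_cast at h
      dsimp only
      linarith
  refine le_trans (le_of_eq ?_) (le_iSup₂_of_le _ hpack le_rfl)
  have hinj : Function.Injective fun x : X => (x, (ρ : ℝ)) := fun x y h => (Prod.ext_iff.1 h).1
  rw [← hinj.encard_image C, ← ENNReal.tsum_set_const]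
  refine tsum_congr ?_
  rintro ⟨_, x, hx, rfl⟩
  rfl

/-- A packing has at most `N_ρ(A)` balls of radius larger than `ρ`, because a ball of radius `ρ`
of a cover contains at most one of their centres. -/
theorem encard_le_externalCoveringNumber_of_isBallPacking {A : Set X} {δ : ℝ} {P : Set (X × ℝ)}
    (hP : IsBallPacking A δ P) (ρ : ℝ≥0) :
    {b ∈ P | (ρ : ℝ) < b.2}.encard ≤ Metric.externalCoveringNumber ρ A := by
  obtain ⟨C, hC, hCe⟩ := exists_isCover_encard_eq ρ A
  rw [← hCe]
  have hex : ∀ b ∈ {b ∈ P | (ρ : ℝ) < b.2}, ∃ c ∈ C, dist b.1 c ≤ ρ := by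
    rintro b ⟨hb, -⟩
    obtain ⟨c, hc, h⟩ := mem_iUnion₂.1
      (Metric.isCover_iff_subset_iUnion_closedBall.1 hC (hP.1 b hb).1)
    exact ⟨c, hc, h⟩
  rcases Set.eq_empty_or_nonempty {b ∈ P | (ρ : ℝ) < b.2} with h | ⟨b₀, hb₀⟩
  · rw [h]; simp
  have : Nonempty X := ⟨b₀.1⟩
  choose! g hg hgd using hex
  refine Set.encard_le_encard_of_injOn (f := g) hg ?_
  intro b hb b' hb' h
  by_contra hne
  have hd : Disjoint (Metric.closedBall b.1 b.2) (Metric.closedBall b'.1 b'.2) :=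
    hP.2 hb.1 hb'.1 hne
  refine Set.disjoint_left.1 hd ?_ (Metric.mem_closedBall.2 ?_ : g b ∈ _)
  · rw [Metric.mem_closedBall, dist_comm]
    exact (hgd b hb).trans hb.2.le
  · rw [dist_comm, h]
    exact (hgd b' hb').trans hb'.2.le

/-- The balls of a packing are sorted by the dyadic size of their radii. -/
theorem packingPreContent_ne_top {A : Set X} {c t : ℝ} {s : ℝ≥0} (hc : 0 < c) (ht : t < s)
    (h : ∀ δ : ℝ≥0, 0 < δ → δ < 1 → (Metric.externalCoveringNumber δ A : ℝ≥0∞) ≤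
      ENNReal.ofReal (c * (δ : ℝ) ^ (-t))) : packingPreContent s 1 A ≠ ∞ := by
  set q : ℝ := 2 ^ (t - s) with hq
  have hq0 : 0 < q := by positivity
  have hq1 : q < 1 := Real.rpow_lt_one_of_one_lt_of_neg one_lt_two (by linarith)
  have hsum : ∑' k : ℕ, ENNReal.ofReal (c * 2 ^ (t + s) * q ^ k) ≠ ∞ := by
    rw [← ENNReal.ofReal_tsum_of_nonneg (fun _ => by positivity)
      ((summable_geometric_of_lt_one hq0.le hq1).mul_left _)]
    exact ENNReal.ofReal_ne_top
  refine ne_top_of_le_ne_top hsum (iSup₂_le fun P hP => ?_)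
  let D : ℕ → Set (X × ℝ) := fun k => {b ∈ P | (1 / 2 : ℝ) ^ (k + 1) < b.2 ∧ b.2 ≤ (1 / 2) ^ k}
  have hPD : P ⊆ ⋃ k, D k := by
    intro b hb
    obtain ⟨-, h0, h1⟩ := hP.1 b hb
    obtain ⟨k, hk1, hk2⟩ := exists_nat_pow_near_of_lt_one h0 h1 (by norm_num : (0 : ℝ) < 1 / 2)
      (by norm_num)
    exact mem_iUnion.2 ⟨k, hb, hk1, hk2⟩
  calc ∑' b : P, ENNReal.ofReal (2 * b.1.2) ^ (s : ℝ)
      ≤ ∑' b : ⋃ k, D k, ENNReal.ofReal (2 * b.1.2) ^ (s : ℝ) :=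
        ENNReal.tsum_mono_subtype (fun b : X × ℝ => ENNReal.ofReal (2 * b.2) ^ (s : ℝ)) hPD
    _ ≤ ∑' k, ∑' b : D k, ENNReal.ofReal (2 * b.1.2) ^ (s : ℝ) :=
        ENNReal.tsum_iUnion_le_tsum (fun b : X × ℝ => ENNReal.ofReal (2 * b.2) ^ (s : ℝ)) D
    _ ≤ ∑' k : ℕ, ENNReal.ofReal (c * 2 ^ (t + s) * q ^ k) := by
        refine ENNReal.tsum_le_tsum fun k => ?_
        have hk : ((2⁻¹ ^ (k + 1) : ℝ≥0) : ℝ) = (1 / 2) ^ (k + 1) := by norm_num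
        have h1 : (((D k).encard : ℕ∞) : ℝ≥0∞) ≤
            ENNReal.ofReal (c * ((1 / 2 : ℝ) ^ (k + 1)) ^ (-t)) := by
          have hle : (D k).encard ≤ Metric.externalCoveringNumber (2⁻¹ ^ (k + 1)) A := by
            refine le_trans (Set.encard_le_encard ?_)
              (encard_le_externalCoveringNumber_of_isBallPacking hP _)
            rintro b ⟨hb, hb1, -⟩
            exact ⟨hb, by rwa [hk]⟩
          rw [← hk]
          refine (ENat.toENNReal_le.2 hle).trans (h _ (by positivity) ?_)
          exact pow_lt_one₀ (by positivity) (inv_lt_one_of_one_lt₀ one_lt_two) (by omega)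
        calc ∑' b : D k, ENNReal.ofReal (2 * b.1.2) ^ (s : ℝ)
            ≤ ∑' _b : D k, ENNReal.ofReal (2 * (1 / 2) ^ k) ^ (s : ℝ) := by
              refine ENNReal.tsum_le_tsum fun b => ?_
              have := b.2.2.2
              gcongr
          _ = ((D k).encard : ℝ≥0∞) * ENNReal.ofReal (2 * (1 / 2) ^ k) ^ (s : ℝ) :=
              ENNReal.tsum_set_const _ _
          _ ≤ ENNReal.ofReal (c * ((1 / 2 : ℝ) ^ (k + 1)) ^ (-t)) *
                ENNReal.ofReal (2 * (1 / 2) ^ k) ^ (s : ℝ) := by gcongr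
          _ = ENNReal.ofReal (c * 2 ^ (t + s) * q ^ k) := by
              rw [ENNReal.ofReal_rpow_of_pos (by positivity),
                ← ENNReal.ofReal_mul (by positivity)]
              congr 1
              have e : ∀ m : ℕ, (1 / 2 : ℝ) ^ m = 2 ^ (-(m : ℝ)) := fun m => by
                rw [Real.rpow_neg zero_le_two, Real.rpow_natCast, one_div, inv_pow]
              have e2 : (2 : ℝ) * 2 ^ (-(k : ℝ)) = 2 ^ (1 - (k : ℝ)) := by
                rw [sub_eq_add_neg, Real.rpow_add two_pos, Real.rpow_one]
              rw [e, e, e2, hq, ← Real.rpow_natCast, ← Real.rpow_mul zero_le_two,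
                ← Real.rpow_mul zero_le_two, ← Real.rpow_mul zero_le_two, mul_assoc, mul_assoc,
                ← Real.rpow_add two_pos, ← Real.rpow_add two_pos]
              congr 2
              push_cast
              ring

theorem packingPreContent_empty (s : ℝ≥0) (δ : ℝ) : packingPreContent s δ (∅ : Set X) = 0 := by
  rw [packingPreContent, ← bot_eq_zero, eq_bot_iff]
  refine iSup₂_le fun P hP => ?_
  have : P = ∅ := eq_empty_of_forall_notMem fun b hb => (hP.1 b hb).1
  subst this
  simp

theorem packingMeasure_le_packingPreMeasure (s : ℝ≥0) (A : Set X) :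
    packingMeasure s A ≤ packingPreMeasure s A := by
  refine (iInf₂_le (fun n : ℕ => if n = 0 then A else ∅)
    (fun x hx => mem_iUnion.2 ⟨0, by simpa using hx⟩)).trans ?_
  rw [tsum_eq_single 0]
  · simp
  · intro n hn
    simp only [if_neg hn]
    rw [← nonpos_iff_eq_zero]
    exact (iInf₂_le 1 one_pos).trans (packingPreContent_empty s 1).le

theorem packingDim_le_of_le {A : Set X} {c : ℝ} {t : ℝ≥0} (hc : 0 < c)
    (h : ∀ δ : ℝ≥0, 0 < δ → δ < 1 → (Metric.externalCoveringNumber δ A : ℝ≥0∞) ≤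
      ENNReal.ofReal (c * (δ : ℝ) ^ (-(t : ℝ)))) : packingDim A ≤ t := by
  refine iSup₂_le fun s hs => ?_
  by_contra! hlt
  have hlt' : (t : ℝ) < s := by exact_mod_cast hlt
  refine packingPreContent_ne_top hc hlt' h (top_le_iff.1 ?_)
  rw [← hs]
  exact (packingMeasure_le_packingPreMeasure s A).trans (iInf₂_le 1 one_pos)

/-- Upper bounds on packing contents are upper bounds on covering numbers, also of closures. -/
theorem exists_externalCoveringNumber_closure_mul_le {s : ℝ≥0} {A : Set X}
    (h : packingPreMeasure s A ≠ ∞) :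
    ∃ K : ℝ≥0∞, K ≠ ∞ ∧ ∀ᶠ δ : ℝ≥0 in 𝓝[>] 0,
      (Metric.externalCoveringNumber δ (closure A) : ℝ≥0∞) * ENNReal.ofReal δ ^ (s : ℝ) ≤ K := by
  have h' : ∃ δ : ℝ, 0 < δ ∧ packingPreContent s δ A < ∞ := by
    simpa [packingPreMeasure, iInf_lt_iff] using lt_top_iff_ne_top.2 h
  obtain ⟨δ₀, hδ₀, hK⟩ := h'
  refine ⟨_, hK.ne, ?_⟩
  filter_upwards [eventually_nnreal_pos_and_lt (ε := ⟨δ₀, hδ₀.le⟩) hδ₀] with δ ⟨hδ, hδ'⟩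
  have hδ1 : (δ : ℝ) < δ₀ := hδ'
  have h2 : 2 * (δ / 2) = δ := by field_simp
  have h2' : 2 * ((δ / 2 : ℝ≥0) : ℝ) = δ := by exact_mod_cast h2
  have hpos : (0 : ℝ) < δ := hδ
  have := externalCoveringNumber_mul_le_packingPreContent s (δ := δ₀) (ρ := δ / 2) (by positivity)
    (by push_cast; linarith) A
  rw [h2, h2'] at this
  refine le_trans ?_ this
  gcongr
  exact externalCoveringNumber_closure_le δ A

end Packing

/-! ### The packing dimension of sets containing all squares -/

/-- For a cover by sets `F i` of finite packing premeasure the covering numbers of the closures of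
finitely many `F i` would be `O(δ ^ (-s))`, whereas they grow at least like `δ ^ (-7/4)`. -/
theorem packingMeasure_eq_top_of_containsAllSquares {B : Set Plane} (hB : ContainsAllSquares B)
    {s : ℝ≥0} (hs : s < 7 / 4) : packingMeasure s B = ∞ := by
  rw [packingMeasure, iInf₂_eq_top]
  intro F hF
  by_contra hfin
  have hpre : ∀ i, packingPreMeasure s (F i) ≠ ∞ := ENNReal.ne_top_of_tsum_ne_top hfin
  choose K hK hKle using fun i => exists_externalCoveringNumber_closure_mul_le (hpre i)
  obtain ⟨n, hn⟩ := exists_volume_lineSquareCenters_ne_zero hB (G := fun i => closure (F i))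
    (fun _ => isClosed_closure) (hF.trans (iUnion_mono fun _ => subset_closure))
  obtain ⟨c, hc, h⟩ := exists_le_externalCoveringNumber (by positivity) hn
  have hε : (0 : ℝ≥0) < 1 / (n + 1) / 2 := by positivity
  have hKn : ∑ i ∈ Finset.range n, K i ≠ ∞ := ENNReal.sum_ne_top.2 fun i _ => hK i
  have hs' : (s : ℝ) - 7 / 4 < 0 := by
    have : (s : ℝ) < 7 / 4 := by exact_mod_cast hs
    linarith
  have hbound : ∀ᶠ δ : ℝ≥0 in 𝓝[>] 0,
      (δ : ℝ) ^ ((s : ℝ) - 7 / 4) ≤ (∑ i ∈ Finset.range n, K i).toReal / c := by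
    filter_upwards [eventually_nnreal_pos_and_lt hε,
      (eventually_all_finset (Finset.range n)).2 fun i _ => hKle i] with δ ⟨hδ0, hδ1⟩ hδK
    have hδ0' : (0 : ℝ) < δ := hδ0
    have hδ1' : (δ : ℝ) < 1 / (n + 1) / 2 := by exact_mod_cast hδ1
    rw [le_div_iff₀ hc, mul_comm, ← ENNReal.ofReal_le_iff_le_toReal hKn]
    have hN : (Metric.externalCoveringNumber δ (⋃ i ∈ Finset.range n, closure (F i)) : ℝ≥0∞) ≤
        ∑ i ∈ Finset.range n, (Metric.externalCoveringNumber δ (closure (F i)) : ℝ≥0∞) := by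
      have := Finset.apply_union_le_sum (f := Metric.externalCoveringNumber (X := Plane) δ)
        (Metric.externalCoveringNumber_empty δ)
        (fun {s t} => externalCoveringNumber_union_le δ s t) (s := fun i => closure (F i))
        (Finset.range n)
      refine (ENat.toENNReal_le.2 this).trans (le_of_eq ?_)
      exact map_sum ENat.toENNRealRingHom _ _
    calc ENNReal.ofReal (c * (δ : ℝ) ^ ((s : ℝ) - 7 / 4))
        = ENNReal.ofReal (c * (δ : ℝ) ^ (-(7 / 4) : ℝ)) * ENNReal.ofReal δ ^ (s : ℝ) := by
          rw [ENNReal.ofReal_rpow_of_pos hδ0', ← ENNReal.ofReal_mul (by positivity), mul_assoc,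
            ← Real.rpow_add hδ0', neg_add_eq_sub]
      _ ≤ (∑ i ∈ Finset.range n, (Metric.externalCoveringNumber δ (closure (F i)) : ℝ≥0∞)) *
            ENNReal.ofReal δ ^ (s : ℝ) := by
          gcongr
          exact (h δ hδ0 (by linarith)).trans hN
      _ ≤ ∑ i ∈ Finset.range n, K i := by
          rw [Finset.sum_mul]
          exact Finset.sum_le_sum hδK
  have hcoe : Tendsto (fun δ : ℝ≥0 => (δ : ℝ)) (𝓝[>] 0) (𝓝[>] 0) :=
    tendsto_nhdsWithin_iff.2
      ⟨(NNReal.continuous_coe.tendsto' 0 0 rfl).mono_left nhdsWithin_le_nhds,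
        eventually_mem_nhdsWithin⟩
  obtain ⟨δ, h1, h2⟩ := (hbound.and (((tendsto_rpow_neg_nhdsGT_zero hs').comp
    hcoe).eventually_gt_atTop ((∑ i ∈ Finset.range n, K i).toReal / c))).exists
  exact absurd h1 (not_le.2 h2)

theorem le_packingDim_of_containsAllSquares {B : Set Plane} (hB : ContainsAllSquares B) :
    (7 / 4 : ℝ≥0∞) ≤ packingDim B := by
  have e : (7 / 4 : ℝ≥0∞) = ((7 / 4 : ℝ≥0) : ℝ≥0∞) := by
    rw [ENNReal.coe_div (by norm_num)]; norm_num
  rw [e]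
  refine ENNReal.le_of_forall_nnreal_lt fun s hs => ?_
  exact le_iSup₂_of_le s
    (packingMeasure_eq_top_of_containsAllSquares hB (by exact_mod_cast hs)) le_rfl

/-! ### Choosing the radius digit by digit -/

theorem bit_add_two_pow_mul {i n : ℕ} (h : i < n) (w m : ℤ) :
    ((w + 2 ^ n * m) / 2 ^ i) % 2 = (w / 2 ^ i) % 2 := by
  obtain ⟨k, rfl⟩ := Nat.exists_eq_add_of_lt h
  have e : w + 2 ^ (i + k + 1) * m = w + 2 ^ i * (2 * (2 ^ k * m)) := by ring
  rw [e, Int.add_mul_ediv_left _ _ (by positivity)]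
  omega

/-- The binary digits of `ρ` can be chosen one after the other, starting with the lowest, so that
for each `i < n` the `i`-th digit of `a i ± ρ` is zero. The sign `e i` and the number `a i` may
depend on `i`. -/
theorem exists_forall_bit_eq_zero (a e : ℕ → ℤ) (he : ∀ i, e i = 1 ∨ e i = -1) (n : ℕ) :
    ∃ ρ : ℤ, ∀ i < n, ((a i + e i * ρ) / 2 ^ i) % 2 = 0 := by
  induction n with
  | zero => exact ⟨0, by simp⟩
  | succ n ih =>
    obtain ⟨ρ, hρ⟩ := ih
    by_cases h : ((a n + e n * ρ) / 2 ^ n) % 2 = 0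
    · refine ⟨ρ, fun i hi => ?_⟩
      rcases Nat.lt_succ_iff_lt_or_eq.1 hi with hi | rfl
      · exact hρ i hi
      · exact h
    · refine ⟨ρ + 2 ^ n, fun i hi => ?_⟩
      have e1 : a i + e i * (ρ + 2 ^ n) = a i + e i * ρ + 2 ^ n * e i := by ring
      rw [e1]
      rcases Nat.lt_succ_iff_lt_or_eq.1 hi with hi | rfl
      · rw [bit_add_two_pow_mul hi, hρ i hi]
      · rw [Int.add_mul_ediv_left _ _ (by positivity)]
        rcases he i with h' | h' <;> rw [h'] at h ⊢ <;> omega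

/-- The integers whose binary digits at the places `j`, `4 + j`, …, `4 (L - 1) + j` are zero. -/
def zeroDigits (j L : ℕ) : Set ℤ :=
  {z | ∀ i < L, (z / 2 ^ (4 * i + j)) % 2 = 0}

/-- The numbers that lie in a closed cell `[z, z + 1] / 16 ^ L` with `z ∈ zeroDigits j L`. -/
def digitLevel (j L : ℕ) : Set ℝ :=
  {x | ∃ z ∈ zeroDigits j L, (z : ℝ) ≤ x * 16 ^ L ∧ x * 16 ^ L ≤ z + 1}

/-- The numbers with an expansion `m + ∑ dᵢ / 16 ^ i`, where `m` is an integer, such that the bit of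
weight `2 ^ j` is zero in each of the hexadecimal digits `dᵢ`. It is described by its closed
approximations `digitLevel j L` in order that it is closed by definition. -/
def digitCantor (j : ℕ) : Set ℝ :=
  ⋂ L, digitLevel j L

open scoped Pointwise in
theorem isClosed_digitLevel (j L : ℕ) : IsClosed (digitLevel j L) := by
  have h1 : IsClosed (((↑) : ℤ → ℝ) '' zeroDigits j L + Icc (0 : ℝ) 1) :=
    (Int.isClosedEmbedding_coe_real.isClosedMap _ (isClosed_discrete _)).add_right_of_isCompact
      isCompact_Icc
  have h2 : digitLevel j L =
      (fun x : ℝ => x * 16 ^ L) ⁻¹' (((↑) : ℤ → ℝ) '' zeroDigits j L + Icc (0 : ℝ) 1) := by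
    ext x
    constructor
    · rintro ⟨z, hz, h1, h2⟩
      exact ⟨z, ⟨z, hz, rfl⟩, x * 16 ^ L - z, ⟨by linarith, by linarith⟩, by ring⟩
    · rintro ⟨_, ⟨z, hz, rfl⟩, y, hy, h⟩
      dsimp only at h
      exact ⟨z, hz, by linarith [hy.1], by linarith [hy.2]⟩
  rw [h2]
  exact h1.preimage (by fun_prop)

theorem isClosed_digitCantor (j : ℕ) : IsClosed (digitCantor j) :=
  isClosed_iInter fun L => isClosed_digitLevel j L

theorem ediv_sixteen_mem_zeroDigits {j L : ℕ} {z : ℤ} (hz : z ∈ zeroDigits j (L + 1)) :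
    z / 16 ∈ zeroDigits j L := by
  intro i hi
  have h := hz (i + 1) (by omega)
  have e : (2 : ℤ) ^ (4 * (i + 1) + j) = 16 * 2 ^ (4 * i + j) := by
    rw [show 4 * (i + 1) + j = 4 + (4 * i + j) by ring, pow_add]; norm_num
  rwa [e, ← Int.ediv_ediv_of_nonneg (by norm_num)] at h

theorem digitLevel_succ_subset (j L : ℕ) : digitLevel j (L + 1) ⊆ digitLevel j L := by
  rintro x ⟨z, hz, h1, h2⟩
  refine ⟨z / 16, ediv_sixteen_mem_zeroDigits hz, ?_⟩
  have h3 : 16 * (z / 16) ≤ z := by omega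
  have h4 : z + 1 ≤ 16 * (z / 16) + 16 := by omega
  have h3' : (16 : ℝ) * ((z / 16 : ℤ) : ℝ) ≤ z := by exact_mod_cast h3
  have h4' : (z : ℝ) + 1 ≤ 16 * ((z / 16 : ℤ) : ℝ) + 16 := by exact_mod_cast h4
  rw [pow_succ] at h1 h2
  constructor <;> linarith

/-- The radius at the scale `16 ^ (-L)`: with `a` and `b` replaced by multiples of `16 ^ (-L)` it is
found digit by digit, the digits at the places `4 i + j` being devoted to the `j`-th side. -/
theorem exists_mem_digitLevel (a b : ℝ) (L : ℕ) :
    ∃ r ∈ Icc (1 : ℝ) 2, a + r ∈ digitLevel 0 L ∧ a - r ∈ digitLevel 1 L ∧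
      b + r ∈ digitLevel 2 L ∧ b - r ∈ digitLevel 3 L := by
  set A : ℤ := ⌊a * 16 ^ L⌋
  set B : ℤ := ⌊b * 16 ^ L⌋
  obtain ⟨ρ₀, hρ₀⟩ := exists_forall_bit_eq_zero (fun i => if i % 4 < 2 then A else B)
    (fun i => if i % 2 = 0 then 1 else -1) (fun i => by split_ifs <;> simp) (4 * L)
  -- adding multiples of `2 ^ (4 L)` does not affect the digits under consideration
  set ρ : ℤ := ρ₀ % 2 ^ (4 * L) + 2 ^ (4 * L) with hρ
  obtain ⟨m, hm⟩ : ∃ m, ρ = ρ₀ + 2 ^ (4 * L) * m :=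
    ⟨1 - ρ₀ / 2 ^ (4 * L), by rw [hρ, Int.emod_def]; ring⟩
  have hbit : ∀ i < 4 * L, (((if i % 4 < 2 then A else B) +
      (if i % 2 = 0 then 1 else -1) * ρ) / 2 ^ i) % 2 = 0 := by
    intro i hi
    rw [hm, mul_add, ← add_assoc, mul_left_comm, bit_add_two_pow_mul hi, hρ₀ i hi]
  have hmem : ∀ j, ∀ w : ℤ, j < 4 →
      ((if j < 2 then A else B) + (if j % 2 = 0 then 1 else -1) * ρ) = w → w ∈ zeroDigits j L := by
    intro j w hj hw i hi
    have h := hbit (4 * i + j) (by omega)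
    rwa [show (4 * i + j) % 4 = j by omega, show (4 * i + j) % 2 = j % 2 by omega, hw] at h
  have h16 : (2 : ℤ) ^ (4 * L) = 16 ^ L := by rw [pow_mul]; norm_num
  have hpos : (0 : ℝ) < 16 ^ L := by positivity
  have hρ1 : (16 : ℤ) ^ L ≤ ρ := by
    have := Int.emod_nonneg ρ₀ (b := 2 ^ (4 * L)) (by positivity)
    omega
  have hρ2 : ρ ≤ 2 * 16 ^ L := by
    have := Int.emod_lt_of_pos ρ₀ (b := 2 ^ (4 * L)) (by positivity)
    omega
  have hρ1' : (16 : ℝ) ^ L ≤ ρ := by exact_mod_cast hρ1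
  have hρ2' : (ρ : ℝ) ≤ 2 * 16 ^ L := by exact_mod_cast hρ2
  have hr : (ρ : ℝ) / 16 ^ L * 16 ^ L = ρ := div_mul_cancel₀ _ hpos.ne'
  have hA1 := Int.floor_le (a * 16 ^ L)
  have hA2 := (Int.lt_floor_add_one (a * 16 ^ L)).le
  have hB1 := Int.floor_le (b * 16 ^ L)
  have hB2 := (Int.lt_floor_add_one (b * 16 ^ L)).le
  refine ⟨ρ / 16 ^ L, ⟨by rwa [le_div_iff₀ hpos, one_mul], by rwa [div_le_iff₀ hpos]⟩,
    ⟨A + ρ, hmem 0 _ (by norm_num) (by simp), ?_⟩,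
    ⟨A - ρ, hmem 1 _ (by norm_num) (by simp; ring), ?_⟩,
    ⟨B + ρ, hmem 2 _ (by norm_num) (by simp), ?_⟩,
    ⟨B - ρ, hmem 3 _ (by norm_num) (by simp; ring), ?_⟩⟩
  all_goals
    push_cast
    first
      | rw [add_mul, hr]
      | rw [sub_mul, hr]
    constructor <;> linarith

theorem exists_mem_digitCantor (a b : ℝ) :
    ∃ r ∈ Icc (1 : ℝ) 2, a + r ∈ digitCantor 0 ∧ a - r ∈ digitCantor 1 ∧
      b + r ∈ digitCantor 2 ∧ b - r ∈ digitCantor 3 := by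
  let R : ℕ → Set ℝ := fun L => Icc 1 2 ∩ {r | a + r ∈ digitLevel 0 L ∧ a - r ∈ digitLevel 1 L ∧
      b + r ∈ digitLevel 2 L ∧ b - r ∈ digitLevel 3 L}
  have hcl : ∀ L, IsClosed (R L) := fun L => isClosed_Icc.inter
    (((isClosed_digitLevel 0 L).preimage (by fun_prop)).inter
    (((isClosed_digitLevel 1 L).preimage (by fun_prop)).inter
    (((isClosed_digitLevel 2 L).preimage (by fun_prop)).inter
    ((isClosed_digitLevel 3 L).preimage (by fun_prop)))))
  obtain ⟨r, hr⟩ := IsCompact.nonempty_iInter_of_sequence_nonempty_isCompact_isClosed R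
    (fun L r ⟨h, h0, h1, h2, h3⟩ => ⟨h, digitLevel_succ_subset 0 L h0,
      digitLevel_succ_subset 1 L h1, digitLevel_succ_subset 2 L h2, digitLevel_succ_subset 3 L h3⟩)
    (fun L => by
      obtain ⟨r, h, h'⟩ := exists_mem_digitLevel a b L
      exact ⟨r, h, h'⟩)
    (isCompact_Icc.inter_right (((isClosed_digitLevel 0 0).preimage (by fun_prop)).inter
    (((isClosed_digitLevel 1 0).preimage (by fun_prop)).inter
    (((isClosed_digitLevel 2 0).preimage (by fun_prop)).inter
    ((isClosed_digitLevel 3 0).preimage (by fun_prop)))))) hcl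
  rw [mem_iInter] at hr
  exact ⟨r, (hr 0).1, mem_iInter.2 fun L => (hr L).2.1, mem_iInter.2 fun L => (hr L).2.2.1,
    mem_iInter.2 fun L => (hr L).2.2.2.1, mem_iInter.2 fun L => (hr L).2.2.2.2⟩

/-! ### A compact set of dimension 7/4 containing all squares -/

/-- The cells of the level `L` of `digitCantor j` that are relevant for the interval `[-2, 3]`. -/
noncomputable def digitCells (j L : ℕ) : Finset ℤ :=
  open scoped Classical in
  (Finset.Ico (-3 * 16 ^ L) (4 * 16 ^ L)).filter (· ∈ zeroDigits j L)

/-- Eight of the sixteen hexadecimal digits have a prescribed bit equal to zero. -/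
theorem card_digitCells_le {j : ℕ} (hj : j < 4) (L : ℕ) : (digitCells j L).card ≤ 7 * 8 ^ L := by
  classical
  induction L with
  | zero =>
    refine (Finset.card_filter_le _ _).trans ?_
    simp
  | succ L ih =>
    set D : Finset ℤ := (Finset.Ico 0 16).filter fun d => (d / 2 ^ j) % 2 = 0 with hD
    have hDc : D.card = 8 := by
      rw [hD]
      interval_cases j <;> decide
    have h : (digitCells j (L + 1)).card ≤ (digitCells j L ×ˢ D).card := by
      refine Finset.card_le_card_of_injOn (fun z => (z / 16, z % 16)) ?_ ?_
      · intro z hz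
        obtain ⟨hzI, hz⟩ := Finset.mem_filter.1 hz
        rw [Finset.mem_Ico, pow_succ] at hzI
        refine Finset.mem_product.2 ⟨Finset.mem_filter.2 ⟨Finset.mem_Ico.2 ?_,
          ediv_sixteen_mem_zeroDigits hz⟩, Finset.mem_filter.2 ⟨Finset.mem_Ico.2 ?_, ?_⟩⟩
        · dsimp only
          constructor <;> omega
        · dsimp only
          constructor <;> omega
        · have h0 := hz 0 (by omega)
          interval_cases j <;> norm_num at h0 ⊢ <;> omega
      · intro z _ z' _ h
        simp only [Prod.mk.injEq] at h
        omega
    rw [Finset.card_product, hDc] at h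
    calc (digitCells j (L + 1)).card ≤ _ := h
      _ ≤ 7 * 8 ^ L * 8 := Nat.mul_le_mul_right _ ih
      _ = 7 * 8 ^ (L + 1) := by ring

/-- The points of `[-2, 3]²` one of whose coordinates lies in a set `digitCantor j`, `j < 4`. -/
def digitGrid : Set Plane :=
  {p | (p 0 ∈ Icc (-2 : ℝ) 3 ∧ p 1 ∈ Icc (-2 : ℝ) 3) ∧
    ((∃ j ∈ Finset.range 4, p 0 ∈ digitCantor j) ∨ ∃ j ∈ Finset.range 4, p 1 ∈ digitCantor j)}

theorem dist_le_of_abs_sub_le {p q : Plane} {h : ℝ} (h0 : |p 0 - q 0| ≤ h) (h1 : |p 1 - q 1| ≤ h) :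
    dist p q ≤ 2 * h := by
  have hh : 0 ≤ h := (abs_nonneg _).trans h0
  rw [EuclideanSpace.dist_eq, Fin.sum_univ_two, Real.dist_eq, Real.dist_eq]
  refine Real.sqrt_le_iff.2 ⟨by positivity, ?_⟩
  nlinarith [abs_nonneg (p 0 - q 0), abs_nonneg (p 1 - q 1)]

theorem isCompact_digitGrid : IsCompact digitGrid := by
  have hW : IsClosed {x : ℝ | ∃ j ∈ Finset.range 4, x ∈ digitCantor j} := by
    have : {x : ℝ | ∃ j ∈ Finset.range 4, x ∈ digitCantor j} =
        ⋃ j ∈ Finset.range 4, digitCantor j := by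
      ext x; simp only [mem_iUnion, exists_prop]; rfl
    rw [this]
    exact isClosed_biUnion_finset fun j _ => isClosed_digitCantor j
  have hc : ∀ i, Continuous fun p : Plane => p i := fun i => by fun_prop
  refine Metric.isCompact_of_isClosed_isBounded ?_ ?_
  · exact ((isClosed_Icc.preimage (hc 0)).inter (isClosed_Icc.preimage (hc 1))).inter
      ((hW.preimage (hc 0)).union (hW.preimage (hc 1)))
  · refine Metric.isBounded_iff.2 ⟨2 * 5, ?_⟩
    rintro p ⟨⟨hp0, hp1⟩, -⟩ q ⟨⟨hq0, hq1⟩, -⟩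
    refine dist_le_of_abs_sub_le (abs_le.2 ⟨?_, ?_⟩) (abs_le.2 ⟨?_, ?_⟩) <;>
      linarith [hp0.1, hp0.2, hp1.1, hp1.2, hq0.1, hq0.2, hq1.1, hq1.2]

theorem containsAllSquares_digitGrid : ContainsAllSquares digitGrid := by
  intro c hc0 hc1
  obtain ⟨r, hr, h0, h1, h2, h3⟩ := exists_mem_digitCantor (c 0) (c 1)
  refine ⟨r, by linarith [hr.1], fun p hp => ?_⟩
  have hp : max |p 0 - c 0| |p 1 - c 1| = r := hp
  have e0 : |p 0 - c 0| ≤ r := hp ▸ le_max_left _ _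
  have e1 : |p 1 - c 1| ≤ r := hp ▸ le_max_right _ _
  have hor : |p 0 - c 0| = r ∨ |p 1 - c 1| = r := by
    rcases max_choice |p 0 - c 0| |p 1 - c 1| with h | h
    · exact Or.inl (h.symm.trans hp)
    · exact Or.inr (h.symm.trans hp)
  rw [abs_le] at e0 e1
  refine ⟨⟨⟨by linarith [hc0.1, hr.2], by linarith [hc0.2, hr.2]⟩,
    ⟨by linarith [hc1.1, hr.2], by linarith [hc1.2, hr.2]⟩⟩, ?_⟩
  have hr0 : 0 ≤ r := by linarith [hr.1]
  rcases hor with h | h <;> rcases (abs_eq hr0).1 h with h | h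
  · exact Or.inl ⟨0, by simp, by rwa [show p 0 = c 0 + r by linarith]⟩
  · exact Or.inl ⟨1, by simp, by rwa [show p 0 = c 0 - r by linarith]⟩
  · exact Or.inr ⟨2, by simp, by rwa [show p 1 = c 1 + r by linarith]⟩
  · exact Or.inr ⟨3, by simp, by rwa [show p 1 = c 1 - r by linarith]⟩

theorem externalCoveringNumber_digitGrid_le (L : ℕ) {δ : ℝ≥0} (hδ : 2 * (1 / 16 : ℝ) ^ L ≤ δ) :
    Metric.externalCoveringNumber δ digitGrid ≤ (392 * 128 ^ L : ℕ) := by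
  classical
  have hpos : (0 : ℝ) < 16 ^ L := by positivity
  set I : Finset ℤ := Finset.Ico (-3 * 16 ^ L) (4 * 16 ^ L)
  set Z : Finset ℤ := (Finset.range 4).biUnion fun j => digitCells j L
  -- corners of the cells that have a digit cell as one side and any cell as the other
  set C : Finset Plane :=
    (Z ×ˢ I).image (fun z => !₂[(z.1 : ℝ) / 16 ^ L, (z.2 : ℝ) / 16 ^ L]) ∪
    (I ×ˢ Z).image (fun z => !₂[(z.1 : ℝ) / 16 ^ L, (z.2 : ℝ) / 16 ^ L])
  have hI : I.card = 7 * 16 ^ L := by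
    rw [Int.card_Ico]
    have : (4 * 16 ^ L - -3 * 16 ^ L : ℤ) = ((7 * 16 ^ L : ℕ) : ℤ) := by push_cast; ring
    rw [this, Int.toNat_natCast]
  have hZ : Z.card ≤ 4 * (7 * 8 ^ L) := by
    have := Finset.card_biUnion_le_card_mul (Finset.range 4) (fun j => digitCells j L) (7 * 8 ^ L)
      (fun j hj => card_digitCells_le (Finset.mem_range.1 hj) L)
    simpa using this
  have hC : C.card ≤ 392 * 128 ^ L := by
    have h1 : C.card ≤ Z.card * I.card + I.card * Z.card := by
      refine (Finset.card_union_le _ _).trans ?_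
      rw [← Finset.card_product, ← Finset.card_product]
      exact Nat.add_le_add Finset.card_image_le Finset.card_image_le
    have h2 : (128 : ℕ) ^ L = 8 ^ L * 16 ^ L := by rw [← mul_pow]; norm_num
    rw [hI] at h1
    calc C.card ≤ _ := h1
      _ = 2 * (Z.card * (7 * 16 ^ L)) := by ring
      _ ≤ 2 * (4 * (7 * 8 ^ L) * (7 * 16 ^ L)) := by gcongr
      _ = 392 * 128 ^ L := by rw [h2]; ring
  have hfloor : ∀ x ∈ Icc (-2 : ℝ) 3, ∃ z ∈ I, (z : ℝ) ≤ x * 16 ^ L ∧ x * 16 ^ L ≤ z + 1 := by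
    intro x hx
    refine ⟨⌊x * 16 ^ L⌋, Finset.mem_Ico.2 ⟨Int.le_floor.2 ?_, Int.floor_lt.2 ?_⟩,
      Int.floor_le _, (Int.lt_floor_add_one _).le⟩ <;> push_cast <;> nlinarith [hx.1, hx.2]
  have hdigit : ∀ x ∈ Icc (-2 : ℝ) 3, (∃ j ∈ Finset.range 4, x ∈ digitCantor j) →
      ∃ z ∈ Z, (z : ℝ) ≤ x * 16 ^ L ∧ x * 16 ^ L ≤ z + 1 := by
    rintro x hx ⟨j, hj, hxj⟩
    obtain ⟨z, hz, h1, h2⟩ := mem_iInter.1 hxj L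
    refine ⟨z, Finset.mem_biUnion.2 ⟨j, hj, Finset.mem_filter.2 ⟨Finset.mem_Ico.2 ⟨?_, ?_⟩, hz⟩⟩,
      h1, h2⟩
    · have h16 : (1 : ℝ) ≤ 16 ^ L := one_le_pow₀ (by norm_num)
      have : (-3 * 16 ^ L : ℝ) ≤ z := by nlinarith [hx.1]
      exact_mod_cast this
    · have : (z : ℝ) < 4 * 16 ^ L := by nlinarith [hx.2]
      exact_mod_cast this
  have hdist : ∀ (p : Plane) (z w : ℤ), ((z : ℝ) ≤ p 0 * 16 ^ L ∧ p 0 * 16 ^ L ≤ z + 1) →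
      ((w : ℝ) ≤ p 1 * 16 ^ L ∧ p 1 * 16 ^ L ≤ w + 1) →
      dist p !₂[(z : ℝ) / 16 ^ L, (w : ℝ) / 16 ^ L] ≤ δ := by
    intro p z w hz hw
    have key : ∀ (x : ℝ) (z : ℤ), ((z : ℝ) ≤ x * 16 ^ L ∧ x * 16 ^ L ≤ z + 1) →
        |x - z / 16 ^ L| ≤ (1 / 16) ^ L := by
      intro x z h
      rw [one_div_pow, show x - z / 16 ^ L = (x * 16 ^ L - z) / 16 ^ L by field_simp, abs_div,
        abs_of_pos hpos]
      gcongr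
      rw [abs_le]
      constructor <;> linarith
    refine (dist_le_of_abs_sub_le (h := (1 / 16) ^ L) ?_ ?_).trans hδ
    · simpa using key _ z hz
    · simpa using key _ w hw
  have hcov : Metric.IsCover δ digitGrid (C : Set Plane) := by
    rw [Metric.isCover_iff_subset_iUnion_closedBall]
    rintro p ⟨⟨hp0, hp1⟩, h | h⟩
    · obtain ⟨z, hz, h1⟩ := hdigit _ hp0 h
      obtain ⟨w, hw, h2⟩ := hfloor _ hp1
      exact mem_iUnion₂.2 ⟨_, Finset.mem_coe.2 (Finset.mem_union_left _
        (Finset.mem_image_of_mem _ (Finset.mk_mem_product hz hw))), hdist p z w h1 h2⟩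
    · obtain ⟨z, hz, h1⟩ := hfloor _ hp0
      obtain ⟨w, hw, h2⟩ := hdigit _ hp1 h
      exact mem_iUnion₂.2 ⟨_, Finset.mem_coe.2 (Finset.mem_union_right _
        (Finset.mem_image_of_mem _ (Finset.mk_mem_product hz hw))), hdist p z w h1 h2⟩
  refine hcov.externalCoveringNumber_le_encard.trans ?_
  rw [Set.encard_coe_eq_coe_finsetCard]
  exact_mod_cast hC

/-- The exponent is explained by `128 = 16 ^ (7/4)`. -/
theorem externalCoveringNumber_digitGrid_le_rpow {δ : ℝ≥0} (hδ : 0 < δ) (hδ1 : δ < 1) :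
    (Metric.externalCoveringNumber δ digitGrid : ℝ≥0∞) ≤
      ENNReal.ofReal (392 * 32 ^ (7 / 4 : ℝ) * (δ : ℝ) ^ (-(7 / 4) : ℝ)) := by
  have hδ' : (0 : ℝ) < δ := hδ
  have hδ1' : (δ : ℝ) < 1 := hδ1
  obtain ⟨k, hk1, hk2⟩ := exists_nat_pow_near_of_lt_one (x := (δ : ℝ) / 2) (y := 1 / 16)
    (by positivity) (by linarith) (by norm_num) (by norm_num)
  have h := externalCoveringNumber_digitGrid_le (k + 1) (δ := δ) (by linarith)
  refine (ENat.toENNReal_le.2 h).trans ?_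
  rw [ENat.toENNReal_coe, ← ENNReal.ofReal_natCast]
  refine ENNReal.ofReal_le_ofReal ?_
  have h1 : (16 : ℝ) ^ (k + 1) ≤ 32 / δ := by
    rw [one_div_pow, le_div_iff₀ (by positivity)] at hk2
    rw [le_div_iff₀ hδ', pow_succ]
    linarith
  have h2 : (128 : ℝ) ^ (k + 1) = ((16 : ℝ) ^ (k + 1)) ^ (7 / 4 : ℝ) := by
    rw [← Real.rpow_natCast, ← Real.rpow_natCast, ← Real.rpow_mul (by norm_num),
      show (128 : ℝ) = 2 ^ (7 : ℝ) by norm_num, show (16 : ℝ) = 2 ^ (4 : ℝ) by norm_num,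
      ← Real.rpow_mul (by norm_num), ← Real.rpow_mul (by norm_num)]
    congr 1
    ring
  push_cast
  calc (392 : ℝ) * 128 ^ (k + 1) = 392 * ((16 : ℝ) ^ (k + 1)) ^ (7 / 4 : ℝ) := by rw [h2]
    _ ≤ 392 * (32 / δ) ^ (7 / 4 : ℝ) := by gcongr
    _ = 392 * 32 ^ (7 / 4 : ℝ) * (δ : ℝ) ^ (-(7 / 4) : ℝ) := by
      rw [Real.div_rpow (by norm_num) hδ'.le, Real.rpow_neg hδ'.le]
      ring

theorem theorem1p2 :
    (∀ B : Set Plane, ContainsAllSquares B →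
      (7 / 4 : ℝ≥0∞) ≤ packingDim B ∧
      ((7 / 4 : ℝ) : EReal) ≤ lowerBoxDim B ∧
      ((7 / 4 : ℝ) : EReal) ≤ upperBoxDim B) ∧
    ∃ B : Set Plane, IsCompact B ∧ ContainsAllSquares B ∧
      packingDim B = (7 / 4 : ℝ≥0∞) ∧
      lowerBoxDim B = ((7 / 4 : ℝ) : EReal) ∧
      upperBoxDim B = ((7 / 4 : ℝ) : EReal) := by
  have hlower : ∀ B : Set Plane, ContainsAllSquares B →
      (7 / 4 : ℝ≥0∞) ≤ packingDim B ∧ ((7 / 4 : ℝ) : EReal) ≤ lowerBoxDim B ∧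
      ((7 / 4 : ℝ) : EReal) ≤ upperBoxDim B := fun B hB =>
    ⟨le_packingDim_of_containsAllSquares hB, le_lowerBoxDim_of_containsAllSquares hB,
      (le_lowerBoxDim_of_containsAllSquares hB).trans (lowerBoxDim_le_upperBoxDim B)⟩
  refine ⟨hlower, digitGrid, isCompact_digitGrid, containsAllSquares_digitGrid, ?_⟩
  obtain ⟨h1, h2, h3⟩ := hlower digitGrid containsAllSquares_digitGrid
  have hc : (0 : ℝ) < 392 * 32 ^ (7 / 4 : ℝ) := by positivity
  have hup : upperBoxDim digitGrid ≤ ((7 / 4 : ℝ) : EReal) := by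
    refine upperBoxDim_le_of_le hc ?_
    filter_upwards [eventually_nnreal_pos_and_lt one_pos] with δ ⟨hδ, hδ1⟩
    exact externalCoveringNumber_digitGrid_le_rpow hδ hδ1
  have hpack : packingDim digitGrid ≤ ((7 / 4 : ℝ≥0) : ℝ≥0∞) :=
    packingDim_le_of_le hc fun δ hδ hδ1 => by
      simpa using externalCoveringNumber_digitGrid_le_rpow hδ hδ1
  refine ⟨le_antisymm (hpack.trans (le_of_eq ?_)) h1,
    le_antisymm ((lowerBoxDim_le_upperBoxDim _).trans hup) h2, le_antisymm hup h3⟩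
  rw [ENNReal.coe_div (by norm_num)]
  norm_num
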